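/- Let $\mathcal T\subset\mathbb R^3$ be a nondegenerate closed tetrahedron with nodes $\boldsymbol p_1,\dots,\boldsymbol p_4$ and volume $V$. Let $T^i$ be its face opposite to $\boldsymbol p_i$, with outward unit normal $\hat{\boldsymbol n}_i$. Let $\boldsymbol\varphi=(\varphi_1,\dots,\varphi_4)^T$ be the linear basis functions, i.e. the affine functions with $\varphi_i(\boldsymbol p_j)=\delta_{ij}$, written as $\boldsymbol\varphi(\boldsymbol r)=\frac1{6V}(\tilde{\boldsymbol a}+\boldsymbol\Lambda^T\boldsymbol r)$ with $\tilde{\boldsymbol a}\in\mathbb R^4$, $\boldsymbol\Lambda\in\mathbb R^{3\times4}$. Let $\overline{\boldsymbol\sigma}^c\in\mathbb R^{3\times 3}$ be the (constant) tensor on $\mathcal T$, $\sigma^\infty>0$, and let $f(\boldsymbol r)=\boldsymbol q\cdot\boldsymbol R\,R^{-3}$ with $\boldsymbol R=\boldsymbol r-\boldsymbol r_0$, $R=|\boldsymbol R|$, be the potential (up to the factor $\frac1{4\pi\sigma^\infty}$) of a dipole at $\boldsymbol r_0$ with moment $\boldsymbol q$. The volume element vector $\boldsymbol b^v\in\mathbb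 R^4$ has the entries $$b^v_i=\frac1{4\pi\sigma^\infty}\int_{\mathcal T}\big\langle\overline{\boldsymbol\sigma}^c\nabla f(\boldsymbol r),\nabla\varphi_i(\boldsymbol r)\big\rangle\,d\boldsymbol r .$$ For a triangle with nodes $\boldsymbol P_1,\boldsymbol P_2,\boldsymbol P_3$ (indices modulo 3) put $\hat{\boldsymbol s}_l=\frac{\boldsymbol P_{l-1}-\boldsymbol P_{l+1}}{|\boldsymbol P_{l-1}-\boldsymbol P_{l+1}|}$, let $\hat{\boldsymbol w}$ be the unit vector in the direction of $\hat{\boldsymbol s}_1\times\hat{\boldsymbol s}_2$, and let $\hat{\boldsymbol m}_l=\hat{\boldsymbol s}_l\times\hat{\boldsymbol w}$. Write $\boldsymbol r_0=\boldsymbol\rho-w_0\hat{\boldsymbol w}$ with $\boldsymbol\rho$ in the plane of the triangle, and let $t_l^0$, $s_l^\pm$ be the reals with $\boldsymbol P_{l+1}=\boldsymbol\rho+t^0_l\hat{\boldsymbol m}_l+s_l^-\hat{\boldsymbol s}_l$ and $\boldsymbol P_{l-1}=\boldsymbol\rho+t^0_l\hat{\boldsymbol m}_l+s_l^+\hat{\boldsymbol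 s}_l$. Let $R_l^0=\sqrt{(t_l^0)^2+w_0^2}$, $R_l^\pm=\sqrt{(s_l^\pm)^2+(t_l^0)^2+w_0^2}$, $$f_{2l}=\ln\frac{R_l^++s_l^+}{R_l^-+s_l^-},\qquad \beta_l=\tan^{-1}\frac{t_l^0s_l^+}{(R_l^0)^2+|w_0|R_l^+}-\tan^{-1}\frac{t_l^0s_l^-}{(R_l^0)^2+|w_0|R_l^-},\qquad \boldsymbol\beta=\beta_1+\beta_2+\beta_3,$$ where $\tan^{-1}$ is the principal branch and a quotient $\frac00$ inside it is read as $0$. A superscript $i$ on these quantities means that they are formed for the face $T^i$, with its nodes numbered in any order. **(a)** If $\boldsymbol r_0\notin\mathcal T$, then the integrals defining $\boldsymbol b^v$ converge absolutely and $$\boldsymbol b^v=\frac{\boldsymbol\Lambda^T\overline{\boldsymbol\sigma}^c}{24V\pi\sigma^\infty}\sum_{i=1}^4\hat{\boldsymbol n}_i\int_{T^i}f\,dS .$$ **(b)** If $\boldsymbol r_0\notin T^i$, then $f$ and $\nabla\frac1R$ are integrable over $T^i$ with respect to surface area and $\int_{T^i}f\,dS=-\boldsymbol q\cdot\int_{T^i}\nabla\frac1R\,dS$.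 If moreover the three quotients in $f^i_{2l}$ are defined, i.e. $R_l^-+s_l^-\neq0$ for $l=1,2,3$ (equivalently, $\boldsymbol r_0$ does not lie on the extension of a side of $T^i$ beyond its end point $\boldsymbol P_{l-1}$), then $$\int_{T^i}f\,dS=-\boldsymbol q\cdot\Big(-\hat{\boldsymbol w}^i\,\mathrm{sgn}(w_0^i)\,\boldsymbol\beta^i+\sum_{l=1}^3\hat{\boldsymbol m}_l^i f_{2l}^i\Big).$$ -/

import Mathlib

open Real MeasureTheory
open scoped Matrix Gradient

noncomputable section

namespace EEG

/-- Euclidean three-space. -/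
abbrev E3 : Type := EuclideanSpace ℝ (Fin 3)

/-- The cross product of `ℝ³`. -/
def cross (a b : E3) : E3 := WithLp.toLp 2 (crossProduct a.ofLp b.ofLp)

/-- The unit vector `v / |v|`. -/
def unit (v : E3) : E3 := ‖v‖⁻¹ • v

/-! ### The dipolar source -/

/-- `1 / R`, where `R = |r - r₀|`. -/
def invDist (r0 r : E3) : ℝ := 1 / ‖r - r0‖

/-- `f(r) = q ⬝ R / R³`, where `R = r - r₀`: the potential of a dipole with moment `q` located
at `r₀`, up to the factor `1 / (4πσ^∞)`. -/
def dipole (q r0 r : E3) : ℝ := inner ℝ q (r - r0) / ‖r - r0‖ ^ 3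

/-! ### The tetrahedral element

A nondegenerate tetrahedron is given by four affinely independent nodes in `ℝ³`, that is, by an
affine basis of `ℝ³` indexed by `Fin 4`. Its linear basis functions, the affine functions with
`φ_i(p_j) = δ_{ij}`, are the barycentric coordinates `p.coord i`. -/

/-- The (closed, solid) tetrahedron. -/
def tetra (p : AffineBasis (Fin 4) ℝ E3) : Set E3 := convexHull ℝ (Set.range p)

/-- The volume `V` of the tetrahedron. -/
def vol (p : AffineBasis (Fin 4) ℝ E3) : ℝ := volume.real (tetra p)

/-- The triangular face opposite to the node `p_i`. -/
def face (p : AffineBasis (Fin 4) ℝ E3) (i : Fin 4) : Set E3 := convexHull ℝ (p '' {j | j ≠ i})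

/-- A (non-normalised) normal vector of the face opposite to the node `p_i`. -/
def faceNormal (p : AffineBasis (Fin 4) ℝ E3) (i : Fin 4) : E3 :=
  cross (p (i.succAbove 1) - p (i.succAbove 0)) (p (i.succAbove 2) - p (i.succAbove 0))

/-- The unit normal of the face opposite to `p_i` that points out of the tetrahedron, i.e. away
from `p_i`. -/
def outwardNormal (p : AffineBasis (Fin 4) ℝ E3) (i : Fin 4) : E3 :=
  Real.sign (inner ℝ (faceNormal p i) (p (i.succAbove 0) - p i)) • unit (faceNormal p i)

/-- The constant coefficients `a_i` of the volume coordinates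
`ξ_i = (a_i + b_i x₁ + c_i x₂ + d_i x₃) / (6V)`. -/
def coefA (p : AffineBasis (Fin 4) ℝ E3) (i : Fin 4) : ℝ := 6 * vol p * p.coord i 0

/-- The `3 × 4` matrix `Λ`, whose `i`-th column consists of the linear coefficients
`b_i, c_i, d_i` of the volume coordinates `ξ_i = (a_i + b_i x₁ + c_i x₂ + d_i x₃) / (6V)`. -/
def Lam (p : AffineBasis (Fin 4) ℝ E3) : Matrix (Fin 3) (Fin 4) ℝ :=
  Matrix.of fun k i => 6 * vol p * (p.coord i).linear (EuclideanSpace.single k 1)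

/-- The integrand `⟨σ^c ∇f, ∇φ_i⟩` of the volume element vector. -/
def bvIntegrand (p : AffineBasis (Fin 4) ℝ E3) (σc : Matrix (Fin 3) (Fin 3) ℝ) (q r0 : E3)
    (i : Fin 4) (r : E3) : ℝ :=
  inner ℝ (WithLp.toLp 2 (σc *ᵥ (∇ (dipole q r0) r).ofLp) : E3) (∇ (fun x => p.coord i x) r)

/-- The volume element vector `b^v`, with entries `(4πσ^∞)⁻¹ ∫_𝒯 ⟨σ^c ∇f, ∇φ_i⟩ dr`. -/
def bv (p : AffineBasis (Fin 4) ℝ E3) (σc : Matrix (Fin 3) (Fin 3) ℝ) (σinf : ℝ) (q r0 : E3) :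
    Fin 4 → ℝ :=
  fun i => 1 / (4 * π * σinf) * ∫ r in tetra p, bvIntegrand p σc q r0 i r

theorem vol_pos (p : AffineBasis (Fin 4) ℝ E3) : 0 < vol p := by
  have hc : IsCompact (tetra p) := (Set.finite_range p).isCompact_convexHull ℝ
  have hi : (interior (tetra p)).Nonempty :=
    interior_convexHull_nonempty_iff_affineSpan_eq_top.2 p.tot
  exact ENNReal.toReal_pos (Measure.measure_pos_of_nonempty_interior _ hi).ne'
    hc.measure_lt_top.ne

/-- `ξ = (6V)⁻¹ (ã + Λᵀ r)`: the numbers `coefA` and the matrix `Lam` are the coefficients of the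
volume coordinates. -/
theorem coord_eq (p : AffineBasis (Fin 4) ℝ E3) (i : Fin 4) (r : E3) :
    p.coord i r = 1 / (6 * vol p) * (coefA p i + ((Lam p)ᵀ *ᵥ r.ofLp) i) := by
  have hV := (vol_pos p).ne'
  have h1 : p.coord i r = (p.coord i).linear r + p.coord i 0 := by
    have := (p.coord i).map_vadd 0 r
    simpa using this
  have h2 : (p.coord i).linear r
      = ∑ k, r k * (p.coord i).linear (EuclideanSpace.single k 1) := by
    have hr : r = ∑ k, r k • (EuclideanSpace.single k 1 : E3) := by
      ext j
      fin_cases j <;> simp [Fin.sum_univ_three]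
    conv_lhs => rw [hr]
    simp
  rw [h1, h2]
  simp only [coefA, Lam, Matrix.mulVec, dotProduct, Matrix.transpose_apply, Matrix.of_apply,
    Fin.sum_univ_three]
  field_simp
  ring

/-! ### The local frame of a triangle

The nodes of a triangle are `P 0, P 1, P 2`, with indices taken modulo `3`; side `l` is the side
opposite to `P l`. -/

/-- `ŝ_l`: the unit vector along side `l`, running from `P (l+1)` to `P (l-1)`. -/
def sHat (P : Fin 3 → E3) (l : Fin 3) : E3 := unit (P (l - 1) - P (l + 1))

/-- `ŵ`: the unit normal of the triangle in the direction of `ŝ_1 × ŝ_2` (sides counted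
from `1`). -/
def wHat (P : Fin 3 → E3) : E3 := unit (cross (sHat P 0) (sHat P 1))

/-- `m̂_l = ŝ_l × ŵ`. -/
def mHat (P : Fin 3 → E3) (l : Fin 3) : E3 := cross (sHat P l) (wHat P)

/-- `w₀`: the signed distance with `r₀ = ρ - w₀ ŵ`, where `ρ` lies in the plane of the
triangle. -/
def w0 (P : Fin 3 → E3) (r0 : E3) : ℝ := inner ℝ (P 0 - r0) (wHat P)

/-- `ρ`: the orthogonal projection of `r₀` onto the plane of the triangle. -/
def rho (P : Fin 3 → E3) (r0 : E3) : E3 := r0 + w0 P r0 • wHat P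

/-- `t_l⁰`: the point of the line of side `l` that is closest to `ρ` is `ρ + t_l⁰ m̂_l`. -/
def t0 (P : Fin 3 → E3) (r0 : E3) (l : Fin 3) : ℝ := inner ℝ (P (l + 1) - rho P r0) (mHat P l)

/-- `s_l⁻`: the starting point of side `l` is `P (l+1) = ρ + t_l⁰ m̂_l + s_l⁻ ŝ_l`. -/
def sMinus (P : Fin 3 → E3) (r0 : E3) (l : Fin 3) : ℝ :=
  inner ℝ (P (l + 1) - rho P r0) (sHat P l)

/-- `s_l⁺`: the end point of side `l` is `P (l-1) = ρ + t_l⁰ m̂_l + s_l⁺ ŝ_l`. -/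
def sPlus (P : Fin 3 → E3) (r0 : E3) (l : Fin 3) : ℝ :=
  inner ℝ (P (l - 1) - rho P r0) (sHat P l)

/-- `R_l⁰`, the distance from `r₀` to the line of side `l`. -/
def Rzero (P : Fin 3 → E3) (r0 : E3) (l : Fin 3) : ℝ := √(t0 P r0 l ^ 2 + w0 P r0 ^ 2)

/-- `R_l⁻`, the distance from `r₀` to the starting point of side `l`. -/
def RMinus (P : Fin 3 → E3) (r0 : E3) (l : Fin 3) : ℝ :=
  √(sMinus P r0 l ^ 2 + t0 P r0 l ^ 2 + w0 P r0 ^ 2)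

/-- `R_l⁺`, the distance from `r₀` to the end point of side `l`. -/
def RPlus (P : Fin 3 → E3) (r0 : E3) (l : Fin 3) : ℝ :=
  √(sPlus P r0 l ^ 2 + t0 P r0 l ^ 2 + w0 P r0 ^ 2)

/-- `f_{2l} = ln ((R_l⁺ + s_l⁺) / (R_l⁻ + s_l⁻))`. -/
def f2 (P : Fin 3 → E3) (r0 : E3) (l : Fin 3) : ℝ :=
  Real.log ((RPlus P r0 l + sPlus P r0 l) / (RMinus P r0 l + sMinus P r0 l))

/-- `β_l`. -/
def betaSide (P : Fin 3 → E3) (r0 : E3) (l : Fin 3) : ℝ :=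
  Real.arctan (t0 P r0 l * sPlus P r0 l / (Rzero P r0 l ^ 2 + |w0 P r0| * RPlus P r0 l)) -
  Real.arctan (t0 P r0 l * sMinus P r0 l / (Rzero P r0 l ^ 2 + |w0 P r0| * RMinus P r0 l))

/-- `β = β_1 + β_2 + β_3`. -/
def beta (P : Fin 3 → E3) (r0 : E3) : ℝ := ∑ l, betaSide P r0 l

/-- The vector `-ŵ sgn(w₀) β + Σ_l m̂_l f_{2l}`. -/
def faceVector (P : Fin 3 → E3) (r0 : E3) : E3 :=
  -((Real.sign (w0 P r0) * beta P r0) • wHat P) + ∑ l, f2 P r0 l • mHat P l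

end EEG

end

/-! Both parts are instances of one divergence theorem, which reduces to the fundamental theorem of
calculus along an edge. Parametrise an `n`-simplex affinely by the corner simplex and slice it by
lines parallel to `P 1 - P 0`. Each line enters through the face opposite `P 1` and leaves through
the face opposite `P 0`, so the integral of a derivative in this direction is the difference of two
parametrised face integrals (`simplexIntegral_fderiv_edge`). Inserting Jacobians turns the weights
into the normal components of the edge. Both sides are linear in the direction, and the edges at one
node span, so `setIntegral_triangle_fderiv` and `setIntegral_tetra_fderiv` follow for all admissible
directions. Surface measure is reached through an isometry of the plane into space.

For (a), `∇φ_i` is constant, so the integrand is the derivative of `f` along a fixed vector, and `f`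
is smooth on the tetrahedron. The divergence theorem gives the sum over the faces; `Λ = 6V (∇φ_1, …,
∇φ_4)` gives the factor `24 = 4 · 6`.

For (b), `f = -q ⬝ ∇(1/R)`, so only `∫ ∇(1/R) dS` is needed (`setIntegral_gradient_invDist`). Its
tangential components are boundary integrals of `1/R`, with primitive `ln (R + s)`. Its normal
component is `-sgn(w₀)` times `∫ |w₀| / R³`, the solid angle of the triangle
(`setIntegral_solidAngle`). For `w₀ ≠ 0` the integrand `|w₀| / R³` is the planar divergence of `(r -
ρ) / (R (R + |w₀|))`. This field is regular even at `ρ`, so no disc around `ρ` has to be removed.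
Its flux through a side has an arctangent as primitive, which gives `β_l`. -/

noncomputable section

namespace EEG

/-! ### Parametrised simplices -/

/-- The corner simplex `{x | 0 ≤ x, ∑ x ≤ 1}` of `ℝⁿ`. -/
def cornerSimplex (n : ℕ) : Set (Fin n → ℝ) := {x | (∀ i, 0 ≤ x i) ∧ ∑ i, x i ≤ 1}

/-- The affine map from the corner simplex onto the simplex with vertices `P`. -/
def simplexMap {E : Type*} [AddCommGroup E] [Module ℝ E] {n : ℕ} (P : Fin (n + 1) → E)
    (x : Fin n → ℝ) : E :=
  P 0 + ∑ i, x i • (P i.succ - P 0)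

theorem isCompact_cornerSimplex (n : ℕ) : IsCompact (cornerSimplex n) := by
  have hcl : IsClosed (cornerSimplex n) := by
    have h : cornerSimplex n = (⋂ i, {x | 0 ≤ x i}) ∩ {x | ∑ i, x i ≤ 1} := by
      ext x; simp [cornerSimplex]
    rw [h]
    exact (isClosed_iInter fun i => isClosed_le continuous_const (continuous_apply i)).inter
      (isClosed_le (by fun_prop) continuous_const)
  refine (isCompact_Icc (a := (0 : Fin n → ℝ)) (b := 1)).of_isClosed_subset hcl ?_
  rintro x ⟨h0, h1⟩
  refine ⟨h0, fun i => ?_⟩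
  exact (Finset.single_le_sum (fun j _ => h0 j) (Finset.mem_univ i)).trans h1

theorem measurableSet_cornerSimplex (n : ℕ) : MeasurableSet (cornerSimplex n) :=
  (isCompact_cornerSimplex n).isClosed.measurableSet

section

variable {E : Type*} [NormedAddCommGroup E] [NormedSpace ℝ E] {n : ℕ}

theorem continuous_simplexMap (P : Fin (n + 1) → E) : Continuous (simplexMap P) := by
  unfold simplexMap
  fun_prop

/-- The convex hull is the linear image of the standard simplex, and dropping the barycentric
coordinate of `P 0`, which is `1 - ∑ x i`, turns the standard simplex into the corner simplex. -/
theorem simplexMap_image (P : Fin (n + 1) → E) :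
    simplexMap P '' cornerSimplex n = convexHull ℝ (Set.range P) := by
  have hr : Set.range P = Fintype.linearCombination ℝ P ''
      Set.range (fun i : Fin (n + 1) => (Pi.single i 1 : Fin (n + 1) → ℝ)) := by
    rw [← Set.range_comp]
    congr 1
    ext i
    simp
  rw [hr, ← LinearMap.image_convexHull, convexHull_rangle_single_eq_stdSimplex]
  ext y
  constructor
  · rintro ⟨x, ⟨h0, h1⟩, rfl⟩
    refine ⟨Fin.cons (1 - ∑ i, x i) x, ⟨fun i => ?_, ?_⟩, ?_⟩
    · refine Fin.cases ?_ (fun j => ?_) i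
      · simpa using h1
      · simpa using h0 j
    · simp [Fin.sum_univ_succ]
    · simp only [Fintype.linearCombination_apply, Fin.sum_univ_succ, Fin.cons_zero, Fin.cons_succ,
        simplexMap, smul_sub, Finset.sum_sub_distrib, sub_smul, one_smul, ← Finset.sum_smul]
      abel
  · rintro ⟨x, ⟨h0, h1⟩, rfl⟩
    rw [Fin.sum_univ_succ] at h1
    refine ⟨fun i => x i.succ, ⟨fun i => h0 _, by linarith [h0 0]⟩, ?_⟩
    have hx : x 0 = 1 - ∑ i : Fin n, x i.succ := by linarith
    simp only [Fintype.linearCombination_apply, Fin.sum_univ_succ, simplexMap, smul_sub,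
      Finset.sum_sub_distrib, hx, sub_smul, one_smul, ← Finset.sum_smul]
    abel

theorem simplexMap_mem (P : Fin (n + 1) → E) {x : Fin n → ℝ} (hx : x ∈ cornerSimplex n) :
    simplexMap P x ∈ convexHull ℝ (Set.range P) :=
  simplexMap_image P ▸ Set.mem_image_of_mem _ hx

/-- The integral of `g` over the simplex with vertices `P`, in the parametrisation `simplexMap`. -/
def simplexIntegral (P : Fin (n + 1) → E) (g : E → ℝ) : ℝ :=
  ∫ x in cornerSimplex n, g (simplexMap P x)

theorem continuousOn_comp_simplexMap {P : Fin (n + 1) → E} {g : E → ℝ}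
    (hg : ContinuousOn g (convexHull ℝ (Set.range P))) :
    ContinuousOn (fun x => g (simplexMap P x)) (cornerSimplex n) :=
  hg.comp (continuous_simplexMap P).continuousOn fun _ hx => simplexMap_mem P hx

theorem integrableOn_comp_simplexMap {P : Fin (n + 1) → E} {g : E → ℝ}
    (hg : ContinuousOn g (convexHull ℝ (Set.range P))) :
    IntegrableOn (fun x => g (simplexMap P x)) (cornerSimplex n) :=
  (continuousOn_comp_simplexMap hg).integrableOn_compact (isCompact_cornerSimplex n)

end

/-! ### Slicing a simplex by lines parallel to an edge. -/

theorem cons_mem_cornerSimplex {n : ℕ} {z : ℝ} {u : Fin n → ℝ} :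
    (Fin.cons z u : Fin (n + 1) → ℝ) ∈ cornerSimplex (n + 1) ↔
      u ∈ cornerSimplex n ∧ z ∈ Set.Icc 0 (1 - ∑ i, u i) := by
  simp only [cornerSimplex, Set.mem_ofPred_eq, Fin.forall_fin_succ, Fin.cons_zero, Fin.cons_succ,
    Fin.sum_univ_succ, Set.mem_Icc]
  constructor
  · rintro ⟨⟨h0, h1⟩, h2⟩
    exact ⟨⟨h1, by linarith⟩, h0, by linarith⟩
  · rintro ⟨⟨h1, -⟩, h0, h2⟩
    exact ⟨⟨h0, h1⟩, by linarith⟩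

/-- Fubini, with the first coordinate innermost: the fibre over `u` is an interval if `u` lies in
the lower corner simplex, and empty otherwise. -/
theorem setIntegral_cornerSimplex_succ {n : ℕ} {F : (Fin (n + 1) → ℝ) → ℝ}
    (hF : IntegrableOn F (cornerSimplex (n + 1))) :
    ∫ x in cornerSimplex (n + 1), F x =
      ∫ u in cornerSimplex n, ∫ z in (0 : ℝ)..(1 - ∑ i, u i), F (Fin.cons z u) := by
  set e := (MeasurableEquiv.piFinSuccAbove (fun _ : Fin (n + 1) => ℝ) 0).symm with he
  have hmp : MeasurePreserving e (volume.prod volume) volume :=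
    (volume_preserving_piFinSuccAbove (fun _ : Fin (n + 1) => ℝ) 0).symm
  have hcons : ∀ z : ℝ, ∀ u : Fin n → ℝ, e (z, u) = (Fin.cons z u : Fin (n + 1) → ℝ) := by
    intro z u
    simp [he, MeasurableEquiv.piFinSuccAbove]
    rfl
  have hint : Integrable (fun y => (cornerSimplex (n + 1)).indicator F (e y))
      ((volume : Measure ℝ).prod (volume : Measure (Fin n → ℝ))) :=
    (hmp.integrable_comp_emb e.measurableEmbedding).2
      ((integrable_indicator_iff (measurableSet_cornerSimplex _)).2 hF)
  rw [← integral_indicator (measurableSet_cornerSimplex _),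
    ← hmp.integral_comp e.measurableEmbedding, integral_prod_symm _ hint,
    ← integral_indicator (measurableSet_cornerSimplex _)]
  congr 1
  ext u
  by_cases hu : u ∈ cornerSimplex n
  · have h1 : (0 : ℝ) ≤ 1 - ∑ i, u i := by linarith [hu.2]
    rw [Set.indicator_of_mem hu, intervalIntegral.integral_of_le h1,
      ← integral_Icc_eq_integral_Ioc, ← integral_indicator measurableSet_Icc]
    congr 1
    ext z
    rw [hcons]
    by_cases hz : z ∈ Set.Icc 0 (1 - ∑ i, u i)
    · rw [Set.indicator_of_mem hz, Set.indicator_of_mem (cons_mem_cornerSimplex.2 ⟨hu, hz⟩)]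
    · rw [Set.indicator_of_notMem hz,
        Set.indicator_of_notMem fun h => hz (cons_mem_cornerSimplex.1 h).2]
  · rw [Set.indicator_of_notMem hu]
    have : ∀ z, (cornerSimplex (n + 1)).indicator F (e (z, u)) = 0 := fun z => by
      rw [hcons, Set.indicator_of_notMem fun h => hu (cons_mem_cornerSimplex.1 h).1]
    simp [this]

section

variable {E : Type*} [NormedAddCommGroup E] [NormedSpace ℝ E] {n : ℕ}

/-- Each fibre is a segment parallel to `P 1 - P 0` whose end `z = 0` lies on the face opposite `P
1`; by `simplexMap_cons_top` the other end lies on the face opposite `P 0`, at the same parameter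
`u`. -/
theorem simplexMap_cons (P : Fin (n + 2) → E) (z : ℝ) (u : Fin n → ℝ) :
    simplexMap P (Fin.cons z u) =
      simplexMap (P ∘ (1 : Fin (n + 2)).succAbove) u + z • (P 1 - P 0) := by
  have h : ∀ i : Fin n, (1 : Fin (n + 2)).succAbove i.succ = i.succ.succ := fun i => by
    rw [← Fin.succ_zero_eq_one, Fin.succ_succAbove_succ, Fin.succAbove_zero]
  simp only [simplexMap, Fin.sum_univ_succ, Fin.cons_zero, Fin.cons_succ, Function.comp, h]
  simp
  abel

theorem simplexMap_cons_top (P : Fin (n + 2) → E) (u : Fin n → ℝ) :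
    simplexMap P (Fin.cons (1 - ∑ i, u i) u) =
      simplexMap (P ∘ (0 : Fin (n + 2)).succAbove) u := by
  simp only [simplexMap, Fin.sum_univ_succ, Fin.cons_zero, Fin.cons_succ, Function.comp,
    Fin.succAbove_zero, Fin.succ_zero_eq_one, smul_sub, Finset.sum_sub_distrib, sub_smul,
    one_smul, ← Finset.sum_smul]
  module

theorem range_comp_subset_convexHull {m : ℕ} (P : Fin n → E) (f : Fin m → Fin n) :
    convexHull ℝ (Set.range (P ∘ f)) ⊆ convexHull ℝ (Set.range P) :=
  convexHull_mono (Set.range_comp_subset_range f P)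

/-- The fundamental theorem of calculus on a simplex, in the direction of an edge. -/
theorem simplexIntegral_fderiv_edge (P : Fin (n + 2) → E) {g : E → ℝ} {g' : E → E →L[ℝ] ℝ}
    (hg : ∀ x ∈ convexHull ℝ (Set.range P), HasFDerivAt g (g' x) x)
    (hg' : ContinuousOn g' (convexHull ℝ (Set.range P))) :
    simplexIntegral P (fun x => g' x (P 1 - P 0)) =
      simplexIntegral (P ∘ (0 : Fin (n + 2)).succAbove) g -
        simplexIntegral (P ∘ (1 : Fin (n + 2)).succAbove) g := by
  have hgc : ContinuousOn g (convexHull ℝ (Set.range P)) := fun x hx =>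
    (hg x hx).continuousAt.continuousWithinAt
  have hc : ContinuousOn (fun x => g' x (P 1 - P 0)) (convexHull ℝ (Set.range P)) :=
    hg'.clm_apply continuousOn_const
  have hi := integrableOn_comp_simplexMap hc
  unfold simplexIntegral
  rw [setIntegral_cornerSimplex_succ hi, ← integral_sub
    (integrableOn_comp_simplexMap (hgc.mono (range_comp_subset_convexHull _ _)))
    (integrableOn_comp_simplexMap (hgc.mono (range_comp_subset_convexHull _ _)))]
  refine setIntegral_congr_fun (measurableSet_cornerSimplex _) fun u hu => ?_
  have h1 : (0 : ℝ) ≤ 1 - ∑ i, u i := by linarith [hu.2]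
  have hmem : ∀ z ∈ Set.uIcc 0 (1 - ∑ i, u i),
      simplexMap P (Fin.cons z u) ∈ convexHull ℝ (Set.range P) := fun z hz =>
    simplexMap_mem P (cons_mem_cornerSimplex.2 ⟨hu, by rwa [Set.uIcc_of_le h1] at hz⟩)
  have hline : ∀ z : ℝ, HasDerivAt (fun z : ℝ => simplexMap P (Fin.cons z u)) (P 1 - P 0) z := by
    intro z
    simp only [simplexMap_cons]
    simpa using ((hasDerivAt_id z).smul_const (P 1 - P 0)).const_add
      (simplexMap (P ∘ (1 : Fin (n + 2)).succAbove) u)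
  have hlc : Continuous (fun z : ℝ => simplexMap P (Fin.cons z u)) :=
    continuous_iff_continuousAt.2 fun z => (hline z).continuousAt
  have key := intervalIntegral.integral_eq_sub_of_hasDerivAt
    (f := fun z => g (simplexMap P (Fin.cons z u)))
    (f' := fun z => g' (simplexMap P (Fin.cons z u)) (P 1 - P 0))
    (a := 0) (b := 1 - ∑ i, u i)
    (fun z hz => (hg _ (hmem z hz)).comp_hasDerivAt z (hline z))
    (ContinuousOn.intervalIntegrable (hc.comp hlc.continuousOn hmem))
  rw [key, simplexMap_cons_top, simplexMap_cons]
  simp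

end

/-! ### Change of variables -/

/-- The matrix whose columns are the edges `P (i + 1) - P 0`. -/
def edgeMatrix {n : ℕ} (P : Fin (n + 1) → EuclideanSpace ℝ (Fin n)) : Matrix (Fin n) (Fin n) ℝ :=
  Matrix.of fun k i => (P i.succ - P 0) k

theorem setIntegral_convexHull_eq {n : ℕ} (P : Fin (n + 1) → EuclideanSpace ℝ (Fin n))
    (hP : (edgeMatrix P).det ≠ 0) (g : EuclideanSpace ℝ (Fin n) → ℝ) :
    ∫ r in convexHull ℝ (Set.range P), g r = |(edgeMatrix P).det| * simplexIntegral P g := by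
  have hψ : ∀ x : Fin n → ℝ,
      (simplexMap P x).ofLp = (P 0).ofLp + (edgeMatrix P).toLin'.toContinuousLinearMap x := by
    intro x
    ext k
    simp [simplexMap, edgeMatrix, Matrix.mulVec, dotProduct, mul_comm]
  have hder : ∀ x ∈ cornerSimplex n, HasFDerivWithinAt (fun x => (simplexMap P x).ofLp)
      ((edgeMatrix P).toLin'.toContinuousLinearMap) (cornerSimplex n) x := by
    intro x _
    simp only [hψ]
    exact ((ContinuousLinearMap.hasFDerivAt _).const_add _).hasFDerivWithinAt
  have hinj : Set.InjOn (fun x => (simplexMap P x).ofLp) (cornerSimplex n) := by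
    intro x _ y _ hxy
    simp only [hψ, add_right_inj] at hxy
    exact Matrix.mulVec_injective_iff_isUnit.2
      ((Matrix.isUnit_iff_isUnit_det _).2 hP.isUnit) (by simpa using hxy)
  -- The change of variables takes place in `Fin n → ℝ`, where the derivative is an endomorphism
  -- given by a matrix; `WithLp.toLp` preserves volume and carries the result to Euclidean space.
  have hcv := integral_image_eq_integral_abs_det_fderiv_smul volume
    (measurableSet_cornerSimplex n) hder hinj (fun y => g (WithLp.toLp 2 y))
  have himg : (fun x => (simplexMap P x).ofLp) '' cornerSimplex n =
      (WithLp.toLp 2 : (Fin n → ℝ) → EuclideanSpace ℝ (Fin n)) ⁻¹'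
        convexHull ℝ (Set.range P) := by
    rw [← simplexMap_image]
    ext y
    constructor
    · rintro ⟨x, hx, rfl⟩
      exact ⟨x, hx, rfl⟩
    · rintro ⟨x, hx, hxy⟩
      exact ⟨x, hx, by simp [hxy]⟩
  rw [himg, (PiLp.volume_preserving_toLp (Fin n)).setIntegral_preimage_emb
    (MeasurableEquiv.toLp 2 (Fin n → ℝ)).measurableEmbedding] at hcv
  rw [hcv, simplexIntegral, ← integral_const_mul]
  simp [ContinuousLinearMap.det, LinearMap.det_toLin']

/-! ### Inner and cross products in `ℝ³` -/

theorem inner_eq (a b : E3) : inner ℝ a b = a 0 * b 0 + a 1 * b 1 + a 2 * b 2 := by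
  simp [PiLp.inner_apply, Fin.sum_univ_three, mul_comm]

theorem cross_zero (a b : E3) : cross a b 0 = a 1 * b 2 - a 2 * b 1 := by
  simp [cross, cross_apply]

theorem cross_one (a b : E3) : cross a b 1 = a 2 * b 0 - a 0 * b 2 := by
  simp [cross, cross_apply]

theorem cross_two (a b : E3) : cross a b 2 = a 0 * b 1 - a 1 * b 0 := by
  simp [cross, cross_apply]

theorem norm_cross_sq (a b : E3) : ‖cross a b‖ ^ 2 = ‖a‖ ^ 2 * ‖b‖ ^ 2 - inner ℝ a b ^ 2 := by
  simp only [← real_inner_self_eq_norm_sq, inner_eq, cross_zero, cross_one, cross_two]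
  ring

/-- The (non-normalised) normal vector of a triangle. -/
def triangleNormal (P : Fin 3 → E3) : E3 := cross (P 1 - P 0) (P 2 - P 0)

theorem norm_unit {v : E3} (hv : v ≠ 0) : ‖unit v‖ = 1 := by
  rw [unit, norm_smul, norm_inv, norm_norm, inv_mul_cancel₀ (norm_ne_zero_iff.2 hv)]

theorem norm_smul_unit (v : E3) : ‖v‖ • unit v = v := by
  by_cases hv : v = 0
  · simp [hv]
  · rw [unit, smul_smul, mul_inv_cancel₀ (norm_ne_zero_iff.2 hv), one_smul]

/-- Gram–Schmidt on the edges `a`, `b` at `P 0` gives an isometric chart of the plane of the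
triangle, in which the edge matrix is triangular with diagonal `‖a‖`, `‖c‖`. Lagrange's identity
yields `‖a × b‖ = ‖a‖ ‖c‖`. The chart turns two-dimensional Hausdorff measure into Lebesgue measure.
-/
theorem exists_isometry_triangle (P : Fin 3 → E3) (hP : triangleNormal P ≠ 0) :
    ∃ (L : EuclideanSpace ℝ (Fin 2) → E3) (Q : Fin 3 → EuclideanSpace ℝ (Fin 2)),
      Isometry L ∧ (∀ x, L (simplexMap Q x) = simplexMap P x) ∧
      |(edgeMatrix Q).det| = ‖triangleNormal P‖ := by
  set a := P 1 - P 0 with ha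
  set b := P 2 - P 0 with hb
  have ha0 : a ≠ 0 := by
    rintro h
    apply hP
    rw [triangleNormal, ← ha, h]
    ext i
    fin_cases i <;> simp [cross_zero, cross_one, cross_two]
  set e₁ := unit a with he₁
  have h11 : ‖e₁‖ = 1 := norm_unit ha0
  have h11' : inner ℝ e₁ e₁ = 1 := by rw [real_inner_self_eq_norm_sq, h11]; norm_num
  set c := b - inner ℝ e₁ b • e₁ with hc
  have hae : a = ‖a‖ • e₁ := (norm_smul_unit a).symm
  have hcb : b = inner ℝ e₁ b • e₁ + c := by rw [hc]; abel
  have h1c : inner ℝ e₁ c = 0 := by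
    rw [hc, inner_sub_right, inner_smul_right, h11']; ring
  have hN : ‖triangleNormal P‖ = ‖a‖ * ‖c‖ := by
    have h1 : ‖triangleNormal P‖ ^ 2 = (‖a‖ * ‖c‖) ^ 2 := by
      have hbb : ‖b‖ ^ 2 = inner ℝ e₁ b ^ 2 + ‖c‖ ^ 2 := by
        conv_lhs => rw [hcb]
        rw [norm_add_sq_real, inner_smul_left, h1c, norm_smul, h11, mul_one, norm_eq_abs, sq_abs]
        ring
      have hab : inner ℝ a b = ‖a‖ * inner ℝ e₁ b := by
        conv_lhs => rw [hae]
        rw [inner_smul_left]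
        simp
      rw [triangleNormal, norm_cross_sq, ← ha, ← hb, hbb, hab]
      ring
    exact (sq_eq_sq₀ (norm_nonneg _) (by positivity)).1 h1
  have hc0 : c ≠ 0 := by
    rintro h
    apply hP
    rw [← norm_eq_zero, hN, h]
    simp
  set e₂ := unit c with he₂
  have h22 : ‖e₂‖ = 1 := norm_unit hc0
  have hce : c = ‖c‖ • e₂ := (norm_smul_unit c).symm
  have h12 : inner ℝ e₁ e₂ = 0 := by
    rw [he₂, unit, inner_smul_right, h1c, mul_zero]
  let L₀ : EuclideanSpace ℝ (Fin 2) →ₗᵢ[ℝ] E3 :=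
    { toFun := fun x => x 0 • e₁ + x 1 • e₂
      map_add' := fun x y => by simp; module
      map_smul' := fun t x => by simp; module
      norm_map' := fun x => by
        rw [← sq_eq_sq₀ (norm_nonneg _) (norm_nonneg _), LinearMap.coe_mk, AddHom.coe_mk,
          norm_add_sq_real,
          EuclideanSpace.norm_sq_eq x, norm_smul, norm_smul, h11, h22, inner_smul_left,
          inner_smul_right, h12, Fin.sum_univ_two]
        ring }
  have hL₀ : ∀ x, L₀ x = x 0 • e₁ + x 1 • e₂ := fun x => rfl
  refine ⟨fun x => P 0 + L₀ x, ![0, !₂[‖a‖, 0], !₂[inner ℝ e₁ b, ‖c‖]], ?_, ?_, ?_⟩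
  · exact (isometry_add_left (P 0)).comp L₀.isometry
  · intro x
    simp only [simplexMap, Fin.sum_univ_two, hL₀]
    simp only [Fin.succ_zero_eq_one, Fin.succ_one_eq_two, ← ha, ← hb]
    conv_rhs => rw [hcb, hce, hae]
    simp
    module
  · rw [Matrix.det_fin_two, hN]
    simp [edgeMatrix, abs_mul]

theorem measure_triangle_ne_top_and_setIntegral (P : Fin 3 → E3) (hP : triangleNormal P ≠ 0) :
    (Measure.euclideanHausdorffMeasure 2 : Measure E3) (convexHull ℝ (Set.range P)) ≠ ⊤ ∧
    ∀ g : E3 → ℝ, ∫ r in convexHull ℝ (Set.range P), g r ∂(Measure.euclideanHausdorffMeasure 2) =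
      ‖triangleNormal P‖ * simplexIntegral P g := by
  obtain ⟨L, Q, hL, hLQ, hdet⟩ := exists_isometry_triangle P hP
  have himg : convexHull ℝ (Set.range P) = L '' convexHull ℝ (Set.range Q) := by
    rw [← simplexMap_image, ← simplexMap_image, Set.image_image]
    simp only [hLQ]
  have hcpt : IsCompact (convexHull ℝ (Set.range Q)) :=
    (Set.finite_range Q).isCompact_convexHull ℝ
  have hemb : MeasurableEmbedding L := hL.isClosedEmbedding.measurableEmbedding
  constructor
  · rw [himg, hL.euclideanHausdorffMeasure_image,
      EuclideanSpace.euclideanHausdorffMeasure_eq_volume]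
    exact hcpt.measure_lt_top.ne
  · intro g
    have hd : (edgeMatrix Q).det ≠ 0 := by
      rw [← abs_ne_zero, hdet]
      exact norm_ne_zero_iff.2 hP
    have h := setIntegral_convexHull_eq Q hd (fun y => g (L y))
    rw [hdet] at h
    have hs : simplexIntegral P g = simplexIntegral Q (fun y => g (L y)) := by
      simp only [simplexIntegral, hLQ]
    rw [hs, ← h, ← EuclideanSpace.euclideanHausdorffMeasure_eq_volume 2, himg,
      ← Measure.restrict_restrict_of_subset (Set.image_subset_range L _),
      ← hL.map_euclideanHausdorffMeasure, hemb.setIntegral_map, hL.injective.preimage_image]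

theorem setIntegral_triangle (P : Fin 3 → E3) (hP : triangleNormal P ≠ 0) (g : E3 → ℝ) :
    ∫ r in convexHull ℝ (Set.range P), g r ∂(Measure.euclideanHausdorffMeasure 2) =
      ‖triangleNormal P‖ * simplexIntegral P g :=
  (measure_triangle_ne_top_and_setIntegral P hP).2 g

theorem integrableOn_triangle {F : Type*} [NormedAddCommGroup F] (P : Fin 3 → E3)
    (hP : triangleNormal P ≠ 0) {g : E3 → F}
    (hg : ContinuousOn g (convexHull ℝ (Set.range P))) :
    IntegrableOn g (convexHull ℝ (Set.range P)) (Measure.euclideanHausdorffMeasure 2) := by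
  have hcpt : IsCompact (convexHull ℝ (Set.range P)) :=
    (Set.finite_range P).isCompact_convexHull ℝ
  obtain ⟨C, hC⟩ := hcpt.exists_bound_of_continuousOn hg
  exact IntegrableOn.of_bound (measure_triangle_ne_top_and_setIntegral P hP).1.lt_top
    (hg.aestronglyMeasurable_of_isCompact hcpt hcpt.isClosed.measurableSet) C
    ((ae_restrict_iff' hcpt.isClosed.measurableSet).2 (Filter.Eventually.of_forall hC))

/-! ### The frame of a triangle -/

theorem inner_cross_left (a b : E3) : inner ℝ a (cross a b) = 0 := by
  simp only [inner_eq, cross_zero, cross_one, cross_two]; ring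

theorem inner_cross_right (a b : E3) : inner ℝ b (cross a b) = 0 := by
  simp only [inner_eq, cross_zero, cross_one, cross_two]; ring

theorem norm_sq_eq (v : E3) : ‖v‖ ^ 2 = v 0 ^ 2 + v 1 ^ 2 + v 2 ^ 2 := by
  simp [EuclideanSpace.norm_sq_eq, Fin.sum_univ_three]

theorem cross_smul_left (c : ℝ) (a b : E3) : cross (c • a) b = c • cross a b := by
  simp [cross]

theorem cross_smul_right (c : ℝ) (a b : E3) : cross a (c • b) = c • cross a b := by
  simp [cross]

theorem unit_smul_of_pos {c : ℝ} (hc : 0 < c) (v : E3) : unit (c • v) = unit v := by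
  rw [unit, unit, norm_smul, norm_of_nonneg hc.le, smul_smul, mul_inv, mul_comm c⁻¹, mul_assoc,
    inv_mul_cancel₀ hc.ne', mul_one]

theorem inner_unit_right (a v : E3) : inner ℝ a (unit v) = ‖v‖⁻¹ * inner ℝ a v := by
  rw [unit, inner_smul_right]

theorem frame_decomposition {s m w : E3} (hs : ‖s‖ = 1) (hm : ‖m‖ = 1) (hw : ‖w‖ = 1)
    (hsm : inner ℝ s m = 0) (hsw : inner ℝ s w = 0) (hmw : inner ℝ m w = 0) (v : E3) :
    v = inner ℝ v s • s + inner ℝ v m • m + inner ℝ v w • w := by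
  have hsm' := (real_inner_comm s m).trans hsm
  have hsw' := (real_inner_comm s w).trans hsw
  have hmw' := (real_inner_comm m w).trans hmw
  have ho : Orthonormal ℝ ![s, m, w] := by
    constructor
    · intro i
      fin_cases i <;> simp [hs, hm, hw]
    · intro i j hij
      fin_cases i <;> fin_cases j <;>
        first
          | exact absurd rfl hij
          | simp [hsm, hsw, hmw, hsm', hsw', hmw']
  let b := basisOfOrthonormalOfCardEqFinrank ho (by simp)
  have hb : ⇑b = ![s, m, w] := coe_basisOfOrthonormalOfCardEqFinrank ho (by simp)
  let o := b.toOrthonormalBasis (by rwa [hb])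
  have ho' : ⇑o = ![s, m, w] := by simp [o, hb]
  have h := o.sum_repr' v
  rw [Fin.sum_univ_three, ho'] at h
  simpa [real_inner_comm v] using h.symm

section Triangle

variable {P : Fin 3 → E3}

theorem inner_sub_triangleNormal (P : Fin 3 → E3) (i j : Fin 3) :
    inner ℝ (P i - P j) (triangleNormal P) = 0 := by
  have h : ∀ i, inner ℝ (P i - P 0) (triangleNormal P) = 0 := by
    intro i
    fin_cases i
    · simp
    · exact inner_cross_left _ _
    · exact inner_cross_right _ _
  rw [← sub_sub_sub_cancel_right _ _ (P 0), inner_sub_left, h, h, sub_zero]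

theorem node_ne_of_normal_ne_zero (hP : triangleNormal P ≠ 0) (l : Fin 3) :
    P (l - 1) - P (l + 1) ≠ 0 := by
  intro h
  apply hP
  rw [sub_eq_zero] at h
  fin_cases l
  · change P 2 = P 1 at h
    ext i
    fin_cases i <;> simp [triangleNormal, cross_zero, cross_one, cross_two, h] <;> ring
  · change P 0 = P 2 at h
    ext i
    fin_cases i <;> simp [triangleNormal, cross_zero, cross_one, cross_two, h]
  · change P 1 = P 0 at h
    ext i
    fin_cases i <;> simp [triangleNormal, cross_zero, cross_one, cross_two, h]

/-- The sides of a triangle sum to zero, so the cross product of two consecutive sides does not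
depend on the pair; normalising the sides only rescales it by a positive factor. -/
theorem wHat_eq (hP : triangleNormal P ≠ 0) : wHat P = unit (triangleNormal P) := by
  have h0 := norm_pos_iff.2 (node_ne_of_normal_ne_zero hP 0)
  have h1 := norm_pos_iff.2 (node_ne_of_normal_ne_zero hP 1)
  change 0 < ‖P 2 - P 1‖ at h0
  change 0 < ‖P 0 - P 2‖ at h1
  have h : cross (P 2 - P 1) (P 0 - P 2) = triangleNormal P := by
    ext i
    fin_cases i <;> simp [triangleNormal, cross_zero, cross_one, cross_two] <;> ring
  change unit (cross (‖P 2 - P 1‖⁻¹ • (P 2 - P 1)) (‖P 0 - P 2‖⁻¹ • (P 0 - P 2))) = _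
  rw [cross_smul_left, cross_smul_right, h, unit_smul_of_pos (by positivity),
    unit_smul_of_pos (by positivity)]

theorem norm_wHat (hP : triangleNormal P ≠ 0) : ‖wHat P‖ = 1 := by
  rw [wHat_eq hP, norm_unit hP]

theorem norm_sHat (hP : triangleNormal P ≠ 0) (l : Fin 3) : ‖sHat P l‖ = 1 :=
  norm_unit (node_ne_of_normal_ne_zero hP l)

theorem inner_sub_wHat (hP : triangleNormal P ≠ 0) (i j : Fin 3) :
    inner ℝ (P i - P j) (wHat P) = 0 := by
  rw [wHat_eq hP, inner_unit_right, inner_sub_triangleNormal, mul_zero]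

theorem inner_sHat_wHat (hP : triangleNormal P ≠ 0) (l : Fin 3) :
    inner ℝ (sHat P l) (wHat P) = 0 := by
  rw [sHat, unit, inner_smul_left, inner_sub_wHat hP, mul_zero]

theorem inner_sHat_mHat (l : Fin 3) : inner ℝ (sHat P l) (mHat P l) = 0 :=
  inner_cross_left _ _

theorem inner_mHat_wHat (l : Fin 3) : inner ℝ (mHat P l) (wHat P) = 0 := by
  rw [real_inner_comm]
  exact inner_cross_right _ _

theorem norm_mHat (hP : triangleNormal P ≠ 0) (l : Fin 3) : ‖mHat P l‖ = 1 := by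
  have h : ‖mHat P l‖ ^ 2 = 1 := by
    rw [mHat, norm_cross_sq, norm_sHat hP, norm_wHat hP, inner_sHat_wHat hP]
    norm_num
  nlinarith [norm_nonneg (mHat P l)]

theorem triangle_frame (hP : triangleNormal P ≠ 0) (l : Fin 3) (v : E3) :
    v = inner ℝ v (sHat P l) • sHat P l + inner ℝ v (mHat P l) • mHat P l +
      inner ℝ v (wHat P) • wHat P :=
  frame_decomposition (norm_sHat hP l) (norm_mHat hP l) (norm_wHat hP) (inner_sHat_mHat l)
    (inner_sHat_wHat hP l) (inner_mHat_wHat l) v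

theorem inner_node_sub_rho (hP : triangleNormal P ≠ 0) (r0 : E3) (i : Fin 3) :
    inner ℝ (P i - rho P r0) (wHat P) = 0 := by
  have h := inner_sub_wHat hP i 0
  have hw : inner ℝ (wHat P) (wHat P) = 1 := by
    rw [real_inner_self_eq_norm_sq, norm_wHat hP]; norm_num
  rw [inner_sub_left] at h
  rw [rho, w0, inner_sub_left, inner_add_left, inner_smul_left, inner_sub_left, hw]
  simp only [RCLike.conj_to_real]
  linarith

theorem side_start (hP : triangleNormal P ≠ 0) (r0 : E3) (l : Fin 3) :
    P (l + 1) = rho P r0 + t0 P r0 l • mHat P l + sMinus P r0 l • sHat P l := by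
  have h := triangle_frame hP l (P (l + 1) - rho P r0)
  rw [inner_node_sub_rho hP, zero_smul, add_zero] at h
  change P (l + 1) - rho P r0 = sMinus P r0 l • sHat P l + t0 P r0 l • mHat P l at h
  rw [sub_eq_iff_eq_add.1 h]
  abel

theorem side_eq (P : Fin 3 → E3) (l : Fin 3) :
    P (l - 1) - P (l + 1) = ‖P (l - 1) - P (l + 1)‖ • sHat P l :=
  (norm_smul_unit _).symm

theorem sPlus_eq (hP : triangleNormal P ≠ 0) (r0 : E3) (l : Fin 3) :
    sPlus P r0 l = sMinus P r0 l + ‖P (l - 1) - P (l + 1)‖ := by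
  have h : inner ℝ (P (l - 1) - P (l + 1)) (sHat P l) = ‖P (l - 1) - P (l + 1)‖ := by
    conv_lhs => rw [side_eq]
    rw [inner_smul_left, real_inner_self_eq_norm_sq, norm_sHat hP]
    simp
  rw [sPlus, sMinus, ← h, ← inner_add_left]
  congr 1
  abel

/-- The point of side `l` with arc length coordinate `s`. -/
def sidePoint (P : Fin 3 → E3) (r0 : E3) (l : Fin 3) (s : ℝ) : E3 :=
  rho P r0 + t0 P r0 l • mHat P l + s • sHat P l

theorem integral_side (hP : triangleNormal P ≠ 0) (r0 : E3) (l : Fin 3) (g : E3 → ℝ) :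
    ∫ s in sMinus P r0 l..sPlus P r0 l, g (sidePoint P r0 l s) =
      ‖P (l - 1) - P (l + 1)‖ *
        ∫ x in (0 : ℝ)..1, g (P (l + 1) + x • (P (l - 1) - P (l + 1))) := by
  have hd := norm_pos_iff.2 (node_ne_of_normal_ne_zero hP l)
  have h := intervalIntegral.smul_integral_comp_mul_add (a := 0) (b := 1)
    (f := fun s => g (sidePoint P r0 l s)) ‖P (l - 1) - P (l + 1)‖ (sMinus P r0 l)
  rw [mul_zero, zero_add, mul_one, add_comm _ (sMinus P r0 l), ← sPlus_eq hP] at h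
  rw [← h, smul_eq_mul]
  congr 2
  ext x
  congr 1
  rw [sidePoint, add_smul, mul_comm, mul_smul, ← side_eq, side_start hP r0 l]
  abel

/-! ### The divergence theorem on a triangle -/

theorem simplexIntegral_segment (Q : Fin 2 → E3) (g : E3 → ℝ) :
    simplexIntegral Q g = ∫ x in (0 : ℝ)..1, g (Q 0 + x • (Q 1 - Q 0)) := by
  have hmp := volume_preserving_funUnique (Fin 1) ℝ
  have h : cornerSimplex 1 = MeasurableEquiv.funUnique (Fin 1) ℝ ⁻¹' Set.Icc 0 1 := by
    ext x
    simp [cornerSimplex]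
  rw [intervalIntegral.integral_of_le zero_le_one, ← integral_Icc_eq_integral_Ioc,
    simplexIntegral, h, ← hmp.setIntegral_preimage_emb
      (MeasurableEquiv.funUnique (Fin 1) ℝ).measurableEmbedding]
  simp [simplexMap]
  rfl

theorem integral_segment_symm (A B : E3) (g : E3 → ℝ) :
    ∫ x in (0 : ℝ)..1, g (A + x • (B - A)) = ∫ x in (0 : ℝ)..1, g (B + x • (A - B)) := by
  have h := intervalIntegral.integral_comp_sub_left (a := 0) (b := 1)
    (fun x => g (B + x • (A - B))) 1
  rw [sub_self, sub_zero] at h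
  rw [← h]
  congr 1
  ext x
  congr 1
  module

/-- Both parametrisations compute the same surface integral, with Jacobians of equal size. The swap
makes the edge lemma available for `P 2 - P 0`. -/
theorem simplexIntegral_swap (hP : triangleNormal P ≠ 0) (g : E3 → ℝ) :
    simplexIntegral ![P 0, P 2, P 1] g = simplexIntegral P g := by
  have hN : triangleNormal ![P 0, P 2, P 1] = -triangleNormal P := by
    ext i
    fin_cases i <;> simp [triangleNormal, cross_zero, cross_one, cross_two] <;> ring
  have hr : Set.range ![P 0, P 2, P 1] = Set.range P := by
    ext x
    simp only [Set.mem_range, Fin.exists_fin_succ]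
    simp
    tauto
  have h := setIntegral_triangle ![P 0, P 2, P 1] (by rw [hN]; exact neg_ne_zero.2 hP) g
  rw [hr, setIntegral_triangle P hP, hN, norm_neg] at h
  exact (mul_left_cancel₀ (norm_ne_zero_iff.2 hP) h).symm

/-- Cramer's rule in the basis `A`, `B`, `A × B`; the coefficient of the normal vanishes. -/
theorem exists_edge_coordinates (hP : triangleNormal P ≠ 0) {v : E3}
    (hv : inner ℝ v (wHat P) = 0) :
    ∃ a b : ℝ, v = a • (P 1 - P 0) + b • (P 2 - P 0) := by
  have hn : ‖triangleNormal P‖ ^ 2 ≠ 0 := pow_ne_zero _ (norm_ne_zero_iff.2 hP)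
  have hv' : inner ℝ v (triangleNormal P) = 0 := by
    rw [wHat_eq hP, inner_unit_right] at hv
    exact (mul_eq_zero.1 hv).resolve_left (inv_ne_zero (norm_ne_zero_iff.2 hP))
  have key : ∀ A B v : E3, ‖cross A B‖ ^ 2 • v = inner ℝ (cross v B) (cross A B) • A +
      inner ℝ (cross A v) (cross A B) • B + inner ℝ v (cross A B) • cross A B := by
    intro A B v
    rw [norm_sq_eq]
    ext i
    fin_cases i <;>
      simp [inner_eq, cross_zero, cross_one, cross_two] <;> ring
  have h := key (P 1 - P 0) (P 2 - P 0) v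
  rw [← triangleNormal, hv', zero_smul, add_zero] at h
  refine ⟨(‖triangleNormal P‖ ^ 2)⁻¹ * inner ℝ (cross v (P 2 - P 0)) (triangleNormal P),
    (‖triangleNormal P‖ ^ 2)⁻¹ * inner ℝ (cross (P 1 - P 0) v) (triangleNormal P), ?_⟩
  rw [mul_smul, mul_smul, ← smul_add, ← h, smul_smul, inv_mul_cancel₀ hn, one_smul]

/-- Weighting a side normal by the length of the side removes the normalisation of `ŝ_l`, so that
the flux identities become polynomial in the nodes up to powers of `‖triangleNormal P‖`. -/
theorem norm_side_smul_mHat (hP : triangleNormal P ≠ 0) (l : Fin 3) :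
    ‖P (l - 1) - P (l + 1)‖ • mHat P l =
      ‖triangleNormal P‖⁻¹ • cross (P (l - 1) - P (l + 1)) (triangleNormal P) := by
  rw [mHat, ← cross_smul_left, ← side_eq, wHat_eq hP, unit, cross_smul_right]

/-- The divergence theorem on a triangle for a field `g v` with `v` parallel to the triangle. -/
theorem setIntegral_triangle_fderiv (hP : triangleNormal P ≠ 0) (r0 : E3) {v : E3}
    (hv : inner ℝ v (wHat P) = 0) {g : E3 → ℝ} {g' : E3 → E3 →L[ℝ] ℝ}
    (hg : ∀ x ∈ convexHull ℝ (Set.range P), HasFDerivAt g (g' x) x)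
    (hg' : ContinuousOn g' (convexHull ℝ (Set.range P))) :
    ∫ r in convexHull ℝ (Set.range P), g' r v ∂(Measure.euclideanHausdorffMeasure 2) =
      ∑ l, inner ℝ v (mHat P l) *
        ∫ s in sMinus P r0 l..sPlus P r0 l, g (sidePoint P r0 l s) := by
  obtain ⟨a, b, rfl⟩ := exists_edge_coordinates hP hv
  have hn := norm_ne_zero_iff.2 hP
  have hr : Set.range ![P 0, P 2, P 1] = Set.range P := by
    ext x
    simp only [Set.mem_range, Fin.exists_fin_succ]
    simp
    tauto
  -- `E l` is the mean of `g` over side `l`. The edge lemma may produce a side in the opposite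
  -- direction, which `integral_segment_symm` corrects.
  set E : Fin 3 → ℝ := fun l => ∫ x in (0 : ℝ)..1, g (P (l + 1) + x • (P (l - 1) - P (l + 1)))
  have h1 : simplexIntegral P (fun r => g' r (P 1 - P 0)) = E 0 - E 1 := by
    rw [simplexIntegral_fderiv_edge P hg hg', simplexIntegral_segment, simplexIntegral_segment]
    congr 1
    exact integral_segment_symm _ _ g
  have h2 : simplexIntegral P (fun r => g' r (P 2 - P 0)) = E 0 - E 2 := by
    rw [← simplexIntegral_swap hP]
    have := simplexIntegral_fderiv_edge ![P 0, P 2, P 1] (g := g) (g' := g')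
      (by rwa [hr]) (by rwa [hr])
    refine this.trans ?_
    rw [simplexIntegral_segment, simplexIntegral_segment]
    congr 1
    exact integral_segment_symm _ _ g
  have hcont : ∀ v, ContinuousOn (fun r => g' r v) (convexHull ℝ (Set.range P)) := fun v =>
    hg'.clm_apply continuousOn_const
  have h3 : simplexIntegral P (fun r => g' r (a • (P 1 - P 0) + b • (P 2 - P 0))) =
      a * (E 0 - E 1) + b * (E 0 - E 2) := by
    rw [← h1, ← h2, simplexIntegral, simplexIntegral, simplexIntegral, ← integral_const_mul,
      ← integral_const_mul, ← integral_add]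
    · simp
    · exact (integrableOn_comp_simplexMap (hcont _)).const_mul a
    · exact (integrableOn_comp_simplexMap (hcont _)).const_mul b
  have hm : ∀ l, inner ℝ (a • (P 1 - P 0) + b • (P 2 - P 0)) (mHat P l) *
      ∫ s in sMinus P r0 l..sPlus P r0 l, g (sidePoint P r0 l s) =
      ‖triangleNormal P‖⁻¹ * inner ℝ (a • (P 1 - P 0) + b • (P 2 - P 0))
        (cross (P (l - 1) - P (l + 1)) (triangleNormal P)) * E l := by
    intro l
    rw [integral_side hP, ← mul_assoc, mul_comm (inner ℝ _ _), ← inner_smul_right,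
      norm_side_smul_mHat hP, inner_smul_right]
  -- The three pairings reproduce the coefficients `a + b`, `-a`, `-b` of `E 0`, `E 1`, `E 2` in
  -- `h3`.
  have c0 : inner ℝ (a • (P 1 - P 0) + b • (P 2 - P 0))
      (cross (P 2 - P 1) (triangleNormal P)) = (a + b) * ‖triangleNormal P‖ ^ 2 := by
    rw [norm_sq_eq]
    simp [triangleNormal, inner_eq, cross_zero, cross_one, cross_two]
    ring
  have c1 : inner ℝ (a • (P 1 - P 0) + b • (P 2 - P 0))
      (cross (P 0 - P 2) (triangleNormal P)) = -a * ‖triangleNormal P‖ ^ 2 := by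
    rw [norm_sq_eq]
    simp [triangleNormal, inner_eq, cross_zero, cross_one, cross_two]
    ring
  have c2 : inner ℝ (a • (P 1 - P 0) + b • (P 2 - P 0))
      (cross (P 1 - P 0) (triangleNormal P)) = -b * ‖triangleNormal P‖ ^ 2 := by
    rw [norm_sq_eq]
    simp [triangleNormal, inner_eq, cross_zero, cross_one, cross_two]
    ring
  rw [setIntegral_triangle P hP, h3]
  simp only [hm]
  rw [Fin.sum_univ_three]
  change _ = _ * inner ℝ _ (cross (P 2 - P 1) _) * _ + _ * inner ℝ _ (cross (P 0 - P 2) _) * _ +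
    _ * inner ℝ _ (cross (P 1 - P 0) _) * _
  rw [c0, c1, c2]
  field_simp
  ring

end Triangle

/-! ### The source functions away from the source -/

theorem hasFDerivAt_norm_sub {r0 r : E3} (h : r ≠ r0) :
    HasFDerivAt (fun r : E3 => ‖r - r0‖) (‖r - r0‖⁻¹ • innerSL ℝ (r - r0)) r := by
  have hn : ‖r - r0‖ ≠ 0 := norm_ne_zero_iff.2 (sub_ne_zero.2 h)
  have h1 := ((((hasFDerivAt_id r).sub_const r0).norm_sq).sqrt (pow_ne_zero 2 hn)).congr_of_eventuallyEq
    (f₁ := fun r : E3 => ‖r - r0‖)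
    (Filter.Eventually.of_forall fun x => (Real.sqrt_sq (norm_nonneg _)).symm)
  refine h1.congr_fderiv ?_
  ext v
  simp only [id, Real.sqrt_sq (norm_nonneg _)]
  simp
  field_simp

theorem hasFDerivAt_radial {r0 r : E3} (h : r ≠ r0) {φ : ℝ → ℝ} {φ' : ℝ}
    (hφ : HasDerivAt φ φ' ‖r - r0‖) :
    HasFDerivAt (fun r : E3 => φ ‖r - r0‖) ((φ' * ‖r - r0‖⁻¹) • innerSL ℝ (r - r0)) r := by
  have := hφ.comp_hasFDerivAt r (hasFDerivAt_norm_sub h)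
  rwa [smul_smul] at this

theorem hasFDerivAt_invDist {r0 r : E3} (h : r ≠ r0) :
    HasFDerivAt (invDist r0) (-(‖r - r0‖ ^ 3)⁻¹ • innerSL ℝ (r - r0)) r := by
  have hn : ‖r - r0‖ ≠ 0 := norm_ne_zero_iff.2 (sub_ne_zero.2 h)
  have h1 := hasFDerivAt_radial h (hasDerivAt_inv hn)
  have h2 : (fun r => ‖r - r0‖⁻¹) = invDist r0 := by
    ext x
    simp [invDist]
  rw [h2] at h1
  convert h1 using 2
  field_simp

theorem gradient_invDist {r0 r : E3} (h : r ≠ r0) :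
    ∇ (invDist r0) r = -(‖r - r0‖ ^ 3)⁻¹ • (r - r0) := by
  rw [gradient, (hasFDerivAt_invDist h).fderiv, map_smul]
  congr 1
  exact (InnerProductSpace.toDual ℝ E3).symm_apply_apply (r - r0)

theorem dipole_eq {q r0 r : E3} (h : r ≠ r0) :
    dipole q r0 r = -inner ℝ q (∇ (invDist r0) r) := by
  rw [gradient_invDist h, inner_smul_right, dipole]
  ring

theorem continuousOn_gradient_invDist (r0 : E3) : ContinuousOn (∇ (invDist r0)) {r0}ᶜ := by
  have h1 : ContinuousOn (fun r : E3 => -(‖r - r0‖ ^ 3)⁻¹) {r0}ᶜ :=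
    (ContinuousOn.inv₀ (by fun_prop) fun r hr =>
      pow_ne_zero 3 (norm_ne_zero_iff.2 (sub_ne_zero.2 hr))).neg
  have h : ContinuousOn (fun r : E3 => -(‖r - r0‖ ^ 3)⁻¹ • (r - r0)) {r0}ᶜ :=
    h1.smul (continuousOn_id.sub continuousOn_const)
  exact h.congr fun r hr => gradient_invDist hr

theorem contDiffOn_norm_sub (r0 : E3) : ContDiffOn ℝ 1 (fun r : E3 => ‖r - r0‖) {r0}ᶜ :=
  fun _ hr => (((contDiffAt_id).sub contDiffAt_const).norm ℝ
    (sub_ne_zero.2 hr)).contDiffWithinAt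

theorem contDiffOn_invDist (r0 : E3) : ContDiffOn ℝ 1 (invDist r0) {r0}ᶜ :=
  contDiffOn_const.div (contDiffOn_norm_sub r0)
    fun _ hr => norm_ne_zero_iff.2 (sub_ne_zero.2 hr)

theorem contDiffOn_dipole (q r0 : E3) : ContDiffOn ℝ 1 (dipole q r0) {r0}ᶜ :=
  (contDiffOn_const.inner ℝ (contDiffOn_id.sub contDiffOn_const)).div
    ((contDiffOn_norm_sub r0).pow 3)
    fun _ hr => pow_ne_zero 3 (norm_ne_zero_iff.2 (sub_ne_zero.2 hr))

theorem hasFDerivAt_of_contDiffOn_compl {r0 r : E3} {g : E3 → ℝ} (hg : ContDiffOn ℝ 1 g {r0}ᶜ)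
    (hr : r ≠ r0) : HasFDerivAt g (fderiv ℝ g r) r :=
  ((hg.differentiableOn one_ne_zero).differentiableAt
    (isOpen_compl_singleton.mem_nhds hr)).hasFDerivAt

theorem continuousOn_fderiv_of_contDiffOn_compl {r0 : E3} {g : E3 → ℝ}
    (hg : ContDiffOn ℝ 1 g {r0}ᶜ) : ContinuousOn (fderiv ℝ g) {r0}ᶜ :=
  hg.continuousOn_fderiv_of_isOpen isOpen_compl_singleton le_rfl

/-! ### Integrals along a side -/

/-- For `c > 0` the root exceeds `|s|`. For `c = 0` the root is `|a|` at the start, so `ha` forces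
`a > 0` and hence `s > 0`. A condition at the starting point of a side thus controls the whole side.
-/
theorem sqrt_add_self_pos {c a s : ℝ} (hc : 0 ≤ c) (ha : √(a ^ 2 + c) + a ≠ 0) (hs : a ≤ s) :
    0 < √(s ^ 2 + c) + s := by
  have hle : ∀ x : ℝ, |x| ≤ √(x ^ 2 + c) := fun x =>
    Real.le_sqrt_of_sq_le (by rw [sq_abs]; linarith)
  rcases hc.eq_or_lt with rfl | hc'
  · have ha' : 0 < a := by
      by_contra h
      apply ha
      rw [add_zero, Real.sqrt_sq_eq_abs, abs_of_nonpos (not_lt.1 h)]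
      ring
    have := Real.sqrt_nonneg (s ^ 2 + 0)
    linarith
  · have : |s| < √(s ^ 2 + c) := Real.lt_sqrt_of_sq_lt (by rw [sq_abs]; linarith)
    linarith [neg_abs_le s]

theorem integral_inv_sqrt_sq_add {c a b : ℝ} (hc : 0 ≤ c) (hab : a ≤ b)
    (ha : √(a ^ 2 + c) + a ≠ 0) :
    ∫ s in a..b, 1 / √(s ^ 2 + c) = Real.log ((√(b ^ 2 + c) + b) / (√(a ^ 2 + c) + a)) := by
  have hpos : ∀ s ∈ Set.uIcc a b, 0 < √(s ^ 2 + c) + s := fun s hs =>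
    sqrt_add_self_pos hc ha (Set.uIcc_of_le hab ▸ hs).1
  -- If `s ^ 2 + c` vanished, so would `s`, and with it the positive quantity in `hpos`.
  have hne : ∀ s ∈ Set.uIcc a b, s ^ 2 + c ≠ 0 := by
    intro s hs h
    have h1 : s = 0 := by nlinarith [sq_nonneg s]
    have h2 := hpos s hs
    rw [h, h1] at h2
    simp at h2
  have hder : ∀ s ∈ Set.uIcc a b,
      HasDerivAt (fun s => Real.log (√(s ^ 2 + c) + s)) (1 / √(s ^ 2 + c)) s := by
    intro s hs
    have h1 : HasDerivAt (fun s : ℝ => s ^ 2 + c) (2 * s) s := by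
      simpa using (hasDerivAt_pow 2 s).add_const c
    have h2 := ((h1.sqrt (hne s hs)).fun_add (hasDerivAt_id' s)).log (hpos s hs).ne'
    convert h2 using 1
    have h3 : √(s ^ 2 + c) ≠ 0 :=
      (Real.sqrt_pos.2 (lt_of_le_of_ne (by positivity) (hne s hs).symm)).ne'
    have h4 := (hpos s hs).ne'
    field_simp
    ring
  rw [intervalIntegral.integral_eq_sub_of_hasDerivAt hder, Real.log_div
    (hpos b Set.right_mem_uIcc).ne' (hpos a Set.left_mem_uIcc).ne']
  refine ContinuousOn.intervalIntegrable (ContinuousOn.div continuousOn_const (by fun_prop) ?_)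
  exact fun s hs => (Real.sqrt_pos.2 (lt_of_le_of_ne (by positivity) (hne s hs).symm)).ne'

/-- The derivative collapses because `(t² + c² + cR)² + t²s² = (t² + c²)(R + c)²` when `R² = s² + t²
+ c²`; the numerator of the quotient rule carries the factor `(t² + c²)(R + c)` as well. -/
theorem hasDerivAt_arctan_side {t c : ℝ} (hc : 0 < c) (s : ℝ) :
    HasDerivAt (fun s => Real.arctan (t * s / (t ^ 2 + c ^ 2 + c * √(s ^ 2 + t ^ 2 + c ^ 2))))
      (t / (√(s ^ 2 + t ^ 2 + c ^ 2) * (√(s ^ 2 + t ^ 2 + c ^ 2) + c))) s := by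
  set R := √(s ^ 2 + t ^ 2 + c ^ 2) with hR
  have hR0 : 0 < R := Real.sqrt_pos.2 (by positivity)
  have hR2 : R ^ 2 = s ^ 2 + t ^ 2 + c ^ 2 := Real.sq_sqrt (by positivity)
  have h1 : HasDerivAt (fun s : ℝ => s ^ 2 + t ^ 2 + c ^ 2) (2 * s) s := by
    simpa using ((hasDerivAt_pow 2 s).add_const (t ^ 2)).add_const (c ^ 2)
  have h2 := ((h1.sqrt (by positivity)).const_mul c).const_add (t ^ 2 + c ^ 2)
  rw [← hR] at h2
  have hD : t ^ 2 + c ^ 2 + c * R ≠ 0 := by positivity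
  have h3 := ((((hasDerivAt_id' s).const_mul t).fun_div h2 hD).arctan)
  convert h3 using 1
  rw [← hR]
  have hs : s ^ 2 = R ^ 2 - t ^ 2 - c ^ 2 := by linarith
  have hden : (t ^ 2 + c ^ 2 + c * R) ^ 2 + t ^ 2 * s ^ 2 =
      (t ^ 2 + c ^ 2) * (R + c) ^ 2 := by
    rw [hs]; ring
  have hden' : 1 + (t * s / (t ^ 2 + c ^ 2 + c * R)) ^ 2 =
      (t ^ 2 + c ^ 2) * (R + c) ^ 2 / (t ^ 2 + c ^ 2 + c * R) ^ 2 := by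
    rw [← hden]
    field_simp
  have hnum : t * 1 * (t ^ 2 + c ^ 2 + c * R) - t * s * (c * (2 * s / (2 * R))) =
      t * (t ^ 2 + c ^ 2) * (R + c) / R := by
    field_simp
    rw [hs]
    ring
  rw [hden', hnum]
  field_simp

theorem integral_side_beta {t c : ℝ} (hc : 0 < c) (a b : ℝ) :
    ∫ s in a..b, t / (√(s ^ 2 + t ^ 2 + c ^ 2) * (√(s ^ 2 + t ^ 2 + c ^ 2) + c)) =
      Real.arctan (t * b / (t ^ 2 + c ^ 2 + c * √(b ^ 2 + t ^ 2 + c ^ 2))) -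
      Real.arctan (t * a / (t ^ 2 + c ^ 2 + c * √(a ^ 2 + t ^ 2 + c ^ 2))) := by
  refine intervalIntegral.integral_eq_sub_of_hasDerivAt
    (fun s _ => hasDerivAt_arctan_side hc s) ?_
  refine Continuous.intervalIntegrable (Continuous.div continuous_const (by fun_prop) ?_) _ _
  intro s
  have : 0 < √(s ^ 2 + t ^ 2 + c ^ 2) := Real.sqrt_pos.2 (by positivity)
  positivity

/-! ### The face vector -/

section Triangle

variable {P : Fin 3 → E3}

theorem norm_sidePoint_sub (hP : triangleNormal P ≠ 0) (r0 : E3) (l : Fin 3) (s : ℝ) :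
    ‖sidePoint P r0 l s - r0‖ = √(s ^ 2 + t0 P r0 l ^ 2 + w0 P r0 ^ 2) := by
  have h : sidePoint P r0 l s - r0 =
      s • sHat P l + t0 P r0 l • mHat P l + w0 P r0 • wHat P := by
    rw [sidePoint, rho]; abel
  rw [← Real.sqrt_sq (norm_nonneg (sidePoint P r0 l s - r0)), h, norm_add_sq_real,
    norm_add_sq_real, inner_add_left]
  simp only [norm_smul, norm_sHat hP, norm_mHat hP, norm_wHat hP, inner_smul_left,
    inner_smul_right, inner_sHat_mHat, inner_sHat_wHat hP, inner_mHat_wHat, norm_eq_abs]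
  simp

theorem integral_side_invDist (hP : triangleNormal P ≠ 0) (r0 : E3) (l : Fin 3)
    (h : RMinus P r0 l + sMinus P r0 l ≠ 0) :
    ∫ s in sMinus P r0 l..sPlus P r0 l, invDist r0 (sidePoint P r0 l s) = f2 P r0 l := by
  simp only [invDist, norm_sidePoint_sub hP, f2, RPlus, RMinus, add_assoc] at h ⊢
  refine integral_inv_sqrt_sq_add (by positivity) ?_ h
  rw [sPlus_eq hP]
  linarith [norm_nonneg (P (l - 1) - P (l + 1))]

theorem inner_sub_wHat_of_mem (hP : triangleNormal P ≠ 0) (r0 : E3) {r : E3}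
    (hr : r ∈ convexHull ℝ (Set.range P)) : inner ℝ (r - r0) (wHat P) = w0 P r0 := by
  rw [← simplexMap_image] at hr
  obtain ⟨x, -, rfl⟩ := hr
  rw [simplexMap, add_sub_right_comm, inner_add_left, sum_inner]
  simp [inner_smul_left, inner_sub_wHat hP, w0]

/-- The planar field `(r - ρ) / (R (R + c))`, with divergence `c / R³` for `c = |w₀|`, tested
against `e`. -/
def solidAngleField (P : Fin 3 → E3) (r0 e r : E3) : ℝ :=
  1 / (‖r - r0‖ * (‖r - r0‖ + |w0 P r0|)) * inner ℝ (r - rho P r0) e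

theorem contDiffOn_solidAngleField (P : Fin 3 → E3) (r0 e : E3) :
    ContDiffOn ℝ 1 (solidAngleField P r0 e) {r0}ᶜ := by
  refine ContDiffOn.mul (contDiffOn_const.div ((contDiffOn_norm_sub r0).mul
    ((contDiffOn_norm_sub r0).add contDiffOn_const)) ?_)
    ((contDiffOn_id.sub contDiffOn_const).inner ℝ contDiffOn_const)
  intro r hr
  have : 0 < ‖r - r0‖ := norm_pos_iff.2 (sub_ne_zero.2 hr)
  positivity

/-- Product rule for a radial factor times a linear one. Since `r0` and `ρ` differ by a multiple of
`ŵ`, which is orthogonal to `e`, the vectors `r - ρ` and `r - r0` have the same component along `e`.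
-/
theorem fderiv_solidAngleField {r0 r e : E3} (hr : r ≠ r0) (he : ‖e‖ = 1)
    (hew : inner ℝ e (wHat P) = 0) :
    fderiv ℝ (solidAngleField P r0 e) r e =
      -(2 * ‖r - r0‖ + |w0 P r0|) / (‖r - r0‖ * (‖r - r0‖ + |w0 P r0|)) ^ 2 * ‖r - r0‖⁻¹ *
        inner ℝ (r - r0) e ^ 2 + 1 / (‖r - r0‖ * (‖r - r0‖ + |w0 P r0|)) := by
  have hR : 0 < ‖r - r0‖ := norm_pos_iff.2 (sub_ne_zero.2 hr)
  set c := |w0 P r0| with hc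
  have hc0 : 0 ≤ c := abs_nonneg _
  have h1 : HasDerivAt (fun x : ℝ => 1 / (x * (x + c)))
      (-(2 * ‖r - r0‖ + c) / (‖r - r0‖ * (‖r - r0‖ + c)) ^ 2) ‖r - r0‖ := by
    have := ((hasDerivAt_id' ‖r - r0‖).fun_mul
      ((hasDerivAt_id' ‖r - r0‖).add_const c)).fun_inv (by positivity)
    exact (this.congr_deriv (by ring)).congr_of_eventuallyEq
      (Filter.Eventually.of_forall fun x => one_div _)
  have h2 : HasFDerivAt (fun r : E3 => inner ℝ (r - rho P r0) e) (innerSL ℝ e) r := by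
    have h := (innerSL ℝ e).hasFDerivAt.comp r ((hasFDerivAt_id r).sub_const (rho P r0))
    rw [ContinuousLinearMap.comp_id] at h
    exact h.congr_of_eventuallyEq
      (Filter.Eventually.of_forall fun x => real_inner_comm _ _)
  have h3 := (hasFDerivAt_radial hr h1).mul h2
  have h4 : inner ℝ (r - rho P r0) e = inner ℝ (r - r0) e := by
    rw [rho, ← sub_sub, inner_sub_left, inner_smul_left, real_inner_comm e (wHat P), hew]
    simp
  have h5 : fderiv ℝ (solidAngleField P r0 e) r = _ := HasFDerivAt.fderiv h3
  rw [h5]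
  simp only [add_apply, smul_apply, innerSL_apply_apply,
    smul_eq_mul, real_inner_self_eq_norm_sq, h4, he]
  ring

/-- The divergence of the planar field is assembled from its components along `ŝ` and `m̂` of side
`0`, each handled by the divergence theorem with a fixed direction. As `w₀ ≠ 0`, the field is smooth
along all sides. -/
theorem setIntegral_solidAngle (hP : triangleNormal P ≠ 0) {r0 : E3}
    (hr0 : r0 ∉ convexHull ℝ (Set.range P)) (hw : w0 P r0 ≠ 0) :
    ∫ r in convexHull ℝ (Set.range P), |w0 P r0| / ‖r - r0‖ ^ 3
      ∂(Measure.euclideanHausdorffMeasure 2) = beta P r0 := by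
  set K := convexHull ℝ (Set.range P)
  have hsub : K ⊆ {r0}ᶜ := fun r hr h => hr0 (h ▸ hr)
  have hKm : MeasurableSet K := ((Set.finite_range P).isCompact_convexHull ℝ).isClosed.measurableSet
  set c := |w0 P r0| with hc
  have hc0 : 0 < c := abs_pos.2 hw
  have hcw : c ^ 2 = w0 P r0 ^ 2 := sq_abs _
  have hcont : ∀ e, ContinuousOn (fun r => fderiv ℝ (solidAngleField P r0 e) r e) K := fun e =>
    ((continuousOn_fderiv_of_contDiffOn_compl (contDiffOn_solidAngleField P r0 e)).mono
      hsub).clm_apply continuousOn_const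
  have hdiv : ∀ e, inner ℝ e (wHat P) = 0 → _ := fun e he =>
    setIntegral_triangle_fderiv hP r0 (v := e) he (g := solidAngleField P r0 e)
      (fun x hx => hasFDerivAt_of_contDiffOn_compl (contDiffOn_solidAngleField P r0 e) (hsub hx))
      ((continuousOn_fderiv_of_contDiffOn_compl (contDiffOn_solidAngleField P r0 e)).mono hsub)
  have hpt : ∀ r ∈ K, c / ‖r - r0‖ ^ 3 =
      fderiv ℝ (solidAngleField P r0 (sHat P 0)) r (sHat P 0) +
      fderiv ℝ (solidAngleField P r0 (mHat P 0)) r (mHat P 0) := by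
    intro r hr
    have hR : 0 < ‖r - r0‖ := norm_pos_iff.2 (sub_ne_zero.2 (hsub hr))
    rw [fderiv_solidAngleField (hsub hr) (norm_sHat hP 0) (inner_sHat_wHat hP 0),
      fderiv_solidAngleField (hsub hr) (norm_mHat hP 0) (inner_mHat_wHat 0), ← hc]
    -- Pythagoras: the normal component of `r - r0` is `w₀` on the whole triangle. With `|r - ρ|² =
    -- R² - c²` the two derivatives add up to `2/(R(R+c)) - (2R+c)(R-c)/(R³(R+c)) = c/R³`.
    have hsq : inner ℝ (r - r0) (sHat P 0) ^ 2 + inner ℝ (r - r0) (mHat P 0) ^ 2 =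
        ‖r - r0‖ ^ 2 - c ^ 2 := by
      have h1 : ‖r - r0‖ ^ 2 = inner ℝ (r - r0) (r - r0) :=
        (real_inner_self_eq_norm_sq _).symm
      have h2 : inner ℝ (r - r0) (r - r0) = inner ℝ (r - r0) (sHat P 0) ^ 2 +
          inner ℝ (r - r0) (mHat P 0) ^ 2 + inner ℝ (r - r0) (wHat P) ^ 2 := by
        conv_lhs => rhs; rw [triangle_frame hP 0 (r - r0)]
        rw [inner_add_right, inner_add_right, inner_smul_right, inner_smul_right,
          inner_smul_right]
        ring
      rw [h1, h2, inner_sub_wHat_of_mem hP r0 hr, hcw]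
      ring
    have hm : inner ℝ (r - r0) (mHat P 0) ^ 2 =
      ‖r - r0‖ ^ 2 - c ^ 2 - inner ℝ (r - r0) (sHat P 0) ^ 2 := by linarith
    rw [hm]
    field_simp
    ring
  rw [setIntegral_congr_fun hKm hpt, integral_add (integrableOn_triangle P hP (hcont _))
    (integrableOn_triangle P hP (hcont _)), hdiv _ (inner_sHat_wHat hP 0),
    hdiv _ (inner_mHat_wHat 0), ← Finset.sum_add_distrib, beta]
  refine Finset.sum_congr rfl fun l _ => ?_
  have hRpos : ∀ s, 0 < √(s ^ 2 + t0 P r0 l ^ 2 + w0 P r0 ^ 2) := fun s =>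
    Real.sqrt_pos.2 (by positivity)
  have hii : ∀ e, IntervalIntegrable (fun s => solidAngleField P r0 e (sidePoint P r0 l s))
      volume (sMinus P r0 l) (sPlus P r0 l) := by
    intro e
    apply Continuous.intervalIntegrable
    simp only [solidAngleField, norm_sidePoint_sub hP]
    refine Continuous.mul (Continuous.div continuous_const (by fun_prop) fun s => ?_) ?_
    · have := hRpos s
      positivity
    · unfold sidePoint
      fun_prop
  rw [← intervalIntegral.integral_const_mul, ← intervalIntegral.integral_const_mul,
    ← intervalIntegral.integral_add ((hii _).const_mul _) ((hii _).const_mul _)]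
  -- The two terms recombine to the normal flux through side `l`, where `(r - ρ) ⬝ m̂_l` has the
  -- constant value `t_l⁰`.
  have hint : ∀ s, inner ℝ (sHat P 0) (mHat P l) *
        solidAngleField P r0 (sHat P 0) (sidePoint P r0 l s) +
      inner ℝ (mHat P 0) (mHat P l) * solidAngleField P r0 (mHat P 0) (sidePoint P r0 l s) =
      t0 P r0 l / (√(s ^ 2 + t0 P r0 l ^ 2 + c ^ 2) *
        (√(s ^ 2 + t0 P r0 l ^ 2 + c ^ 2) + c)) := by
    intro s
    have h1 : inner ℝ (sidePoint P r0 l s - rho P r0) (mHat P l) = t0 P r0 l := by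
      rw [sidePoint, add_assoc, add_sub_cancel_left, inner_add_left, inner_smul_left,
        inner_smul_left, inner_sHat_mHat, real_inner_self_eq_norm_sq, norm_mHat hP]
      simp
    have h2 : inner ℝ (mHat P l) (wHat P) = 0 := inner_mHat_wHat l
    have h3 := triangle_frame hP 0 (mHat P l)
    rw [h2, zero_smul, add_zero] at h3
    have h4 : t0 P r0 l =
        inner ℝ (mHat P l) (sHat P 0) * inner ℝ (sidePoint P r0 l s - rho P r0) (sHat P 0) +
        inner ℝ (mHat P l) (mHat P 0) * inner ℝ (sidePoint P r0 l s - rho P r0) (mHat P 0) := by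
      conv_lhs => rw [← h1, h3]
      rw [inner_add_right, inner_smul_right, inner_smul_right]
    rw [hcw, solidAngleField, solidAngleField, norm_sidePoint_sub hP, ← hc,
      real_inner_comm (mHat P l), real_inner_comm (mHat P l)]
    generalize √(s ^ 2 + t0 P r0 l ^ 2 + w0 P r0 ^ 2) = R
    linear_combination (-(1 / (R * (R + c)))) * h4
  simp only [hint]
  rw [integral_side_beta hc0, betaSide, Rzero, RPlus, RMinus, Real.sq_sqrt (by positivity), hcw]

/-- Two vectors agree if their components in the frame of side `0` do. The tangential components
give the logarithms, the normal one gives `β`. -/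
theorem setIntegral_gradient_invDist (hP : triangleNormal P ≠ 0) {r0 : E3}
    (hr0 : r0 ∉ convexHull ℝ (Set.range P))
    (hlog : ∀ l, RMinus P r0 l + sMinus P r0 l ≠ 0) :
    ∫ r in convexHull ℝ (Set.range P), ∇ (invDist r0) r ∂(Measure.euclideanHausdorffMeasure 2) =
      faceVector P r0 := by
  set K := convexHull ℝ (Set.range P)
  have hsub : K ⊆ {r0}ᶜ := fun r hr h => hr0 (h ▸ hr)
  have hKm : MeasurableSet K := ((Set.finite_range P).isCompact_convexHull ℝ).isClosed.measurableSet
  have hint : IntegrableOn (∇ (invDist r0)) K (Measure.euclideanHausdorffMeasure 2) :=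
    integrableOn_triangle P hP ((continuousOn_gradient_invDist r0).mono hsub)
  set V := ∫ r in K, ∇ (invDist r0) r ∂(Measure.euclideanHausdorffMeasure 2) with hV
  have hVv : ∀ v, inner ℝ V v =
      ∫ r in K, fderiv ℝ (invDist r0) r v ∂(Measure.euclideanHausdorffMeasure 2) := by
    intro v
    rw [real_inner_comm, hV, ← integral_inner hint]
    refine setIntegral_congr_fun hKm fun r hr => ?_
    rw [real_inner_comm, gradient, InnerProductSpace.toDual_symm_apply]
  have htan : ∀ v, inner ℝ v (wHat P) = 0 → inner ℝ V v = inner ℝ (faceVector P r0) v := by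
    intro v hv
    rw [hVv, setIntegral_triangle_fderiv hP r0 hv (g := invDist r0)
      (fun x hx => hasFDerivAt_of_contDiffOn_compl (contDiffOn_invDist r0) (hsub hx))
      ((continuousOn_fderiv_of_contDiffOn_compl (contDiffOn_invDist r0)).mono hsub),
      faceVector, inner_add_left, inner_neg_left, inner_smul_left, real_inner_comm v, hv,
      mul_zero, neg_zero, zero_add, sum_inner]
    refine Finset.sum_congr rfl fun l _ => ?_
    rw [integral_side_invDist hP r0 l (hlog l), inner_smul_left, real_inner_comm v, mul_comm]
    rfl
  have hnor : inner ℝ V (wHat P) = inner ℝ (faceVector P r0) (wHat P) := by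
    have h1 : inner ℝ (faceVector P r0) (wHat P) = -(Real.sign (w0 P r0) * beta P r0) := by
      rw [faceVector, inner_add_left, inner_neg_left, inner_smul_left, sum_inner,
        real_inner_self_eq_norm_sq, norm_wHat hP]
      simp [inner_smul_left, inner_mHat_wHat]
    have h2 : inner ℝ V (wHat P) = -Real.sign (w0 P r0) *
        ∫ r in K, |w0 P r0| / ‖r - r0‖ ^ 3 ∂(Measure.euclideanHausdorffMeasure 2) := by
      rw [hVv, ← integral_const_mul]
      refine setIntegral_congr_fun hKm fun r hr => ?_
      rw [(hasFDerivAt_invDist (hsub hr)).fderiv]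
      have h3 : inner ℝ (r - r0) (wHat P) = Real.sign (w0 P r0) * |w0 P r0| := by
        rw [inner_sub_wHat_of_mem hP r0 hr]
        rcases lt_trichotomy (w0 P r0) 0 with h | h | h
        · rw [Real.sign_of_neg h, abs_of_neg h]; ring
        · simp [h]
        · rw [Real.sign_of_pos h, abs_of_pos h]; ring
      simp only [smul_apply, innerSL_apply_apply, smul_eq_mul]
      rw [h3]
      ring
    rw [h1, h2]
    -- For a source in the plane of the triangle the sign is `0` and both sides vanish, whatever the
    -- value of `β`.
    by_cases hw : w0 P r0 = 0
    · simp [hw]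
    · rw [setIntegral_solidAngle hP hr0 hw]
      ring
  rw [triangle_frame hP 0 V, triangle_frame hP 0 (faceVector P r0),
    htan _ (inner_sHat_wHat hP 0), htan _ (inner_mHat_wHat 0), hnor]

end Triangle

/-! ### The divergence theorem on a tetrahedron -/

theorem linearIndependent_edges {n : ℕ} {P : Fin (n + 1) → E3} (hP : AffineIndependent ℝ P) :
    LinearIndependent ℝ fun i : Fin n => (P i.succ - P 0).ofLp := by
  have h := (affineIndependent_iff_linearIndependent_vsub ℝ P 0).1 hP
  have h1 := h.comp (fun i : Fin n => (⟨i.succ, Fin.succ_ne_zero i⟩ : {x : Fin (n + 1) // x ≠ 0}))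
    fun i j hij => by simpa using hij
  exact h1.map' (WithLp.linearEquiv 2 ℝ (Fin 3 → ℝ)).toLinearMap (LinearEquiv.ker _)

theorem triangleNormal_ne_zero {P : Fin 3 → E3} (hP : AffineIndependent ℝ P) :
    triangleNormal P ≠ 0 := by
  have h := linearIndependent_edges hP
  have h1 : LinearIndependent ℝ ![(P 1 - P 0).ofLp, (P 2 - P 0).ofLp] := by
    convert h using 1
    ext i
    fin_cases i <;> rfl
  intro h0
  refine crossProduct_ne_zero_iff_linearIndependent.2 h1 ?_
  exact congrArg WithLp.ofLp h0

theorem det_edgeMatrix_ne_zero {P : Fin 4 → E3} (hP : AffineIndependent ℝ P) :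
    (edgeMatrix P).det ≠ 0 := by
  have h := linearIndependent_edges hP
  have h1 : IsUnit (edgeMatrix P) := Matrix.linearIndependent_cols_iff_isUnit.1 h
  exact ((Matrix.isUnit_iff_isUnit_det _).1 h1).ne_zero

/-- A triple product. Together with `det_edgeMatrix_eq_one_face` it expresses one volume Jacobian
through the normal of either face that the edge joins, so that division by the area Jacobian leaves
the normal component of the edge. -/
theorem det_edgeMatrix_eq_zero_face (P : Fin 4 → E3) :
    (edgeMatrix P).det = inner ℝ (triangleNormal (P ∘ (0 : Fin 4).succAbove)) (P 1 - P 0) := by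
  rw [Matrix.det_fin_three, inner_eq]
  change _ = cross (P 2 - P 1) (P 3 - P 1) 0 * _ + cross (P 2 - P 1) (P 3 - P 1) 1 * _ +
    cross (P 2 - P 1) (P 3 - P 1) 2 * _
  rw [cross_zero, cross_one, cross_two]
  simp only [edgeMatrix, Matrix.of_apply, PiLp.sub_apply, Fin.succ_zero_eq_one,
    Fin.succ_one_eq_two, show Fin.succ (2 : Fin 3) = 3 from rfl]
  ring

theorem det_edgeMatrix_eq_one_face (P : Fin 4 → E3) :
    (edgeMatrix P).det = inner ℝ (triangleNormal (P ∘ (1 : Fin 4).succAbove)) (P 1 - P 0) := by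
  rw [Matrix.det_fin_three, inner_eq]
  change _ = cross (P 2 - P 0) (P 3 - P 0) 0 * _ + cross (P 2 - P 0) (P 3 - P 0) 1 * _ +
    cross (P 2 - P 0) (P 3 - P 0) 2 * _
  rw [cross_zero, cross_one, cross_two]
  simp only [edgeMatrix, Matrix.of_apply, PiLp.sub_apply, Fin.succ_zero_eq_one,
    Fin.succ_one_eq_two, show Fin.succ (2 : Fin 3) = 3 from rfl]
  ring

theorem setIntegral_tetra_fderiv_edge {P : Fin 4 → E3} (hP : AffineIndependent ℝ P)
    {g : E3 → ℝ} {g' : E3 → E3 →L[ℝ] ℝ}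
    (hg : ∀ x ∈ convexHull ℝ (Set.range P), HasFDerivAt g (g' x) x)
    (hg' : ContinuousOn g' (convexHull ℝ (Set.range P))) :
    ∫ r in convexHull ℝ (Set.range P), g' r (P 1 - P 0) =
      |inner ℝ (triangleNormal (P ∘ (0 : Fin 4).succAbove)) (P 1 - P 0)| /
        ‖triangleNormal (P ∘ (0 : Fin 4).succAbove)‖ *
        ∫ r in convexHull ℝ (Set.range (P ∘ (0 : Fin 4).succAbove)), g r
          ∂(Measure.euclideanHausdorffMeasure 2) -
      |inner ℝ (triangleNormal (P ∘ (1 : Fin 4).succAbove)) (P 1 - P 0)| /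
        ‖triangleNormal (P ∘ (1 : Fin 4).succAbove)‖ *
        ∫ r in convexHull ℝ (Set.range (P ∘ (1 : Fin 4).succAbove)), g r
          ∂(Measure.euclideanHausdorffMeasure 2) := by
  have h0 := triangleNormal_ne_zero (hP.comp_embedding (0 : Fin 4).succAboveEmb)
  have h1 := triangleNormal_ne_zero (hP.comp_embedding (1 : Fin 4).succAboveEmb)
  change triangleNormal (P ∘ (0 : Fin 4).succAbove) ≠ 0 at h0
  change triangleNormal (P ∘ (1 : Fin 4).succAbove) ≠ 0 at h1
  rw [setIntegral_triangle _ h0, setIntegral_triangle _ h1, ← det_edgeMatrix_eq_zero_face,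
    ← det_edgeMatrix_eq_one_face, setIntegral_convexHull_eq P (det_edgeMatrix_ne_zero hP),
    simplexIntegral_fderiv_edge P hg hg']
  have h0' := norm_ne_zero_iff.2 h0
  have h1' := norm_ne_zero_iff.2 h1
  field_simp

section Tetrahedron

variable (p : AffineBasis (Fin 4) ℝ E3)

theorem face_eq (i : Fin 4) : face p i = convexHull ℝ (Set.range (p ∘ i.succAbove)) := by
  rw [Set.range_comp, Fin.range_succAbove]
  rfl

theorem isCompact_tetra : IsCompact (tetra p) := (Set.finite_range p).isCompact_convexHull ℝ

theorem faceNormal_ne_zero (i : Fin 4) : faceNormal p i ≠ 0 :=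
  triangleNormal_ne_zero (p.ind.comp_embedding i.succAboveEmb)

theorem inner_faceNormal_sub {i j k : Fin 4} (hj : j ≠ i) (hk : k ≠ i) :
    inner ℝ (faceNormal p i) (p j - p k) = 0 := by
  obtain ⟨a, rfl⟩ := Fin.exists_succAbove_eq hj
  obtain ⟨b, rfl⟩ := Fin.exists_succAbove_eq hk
  rw [real_inner_comm]
  exact inner_sub_triangleNormal (p ∘ i.succAbove) a b

theorem inner_outwardNormal_sub_of_ne {i j k : Fin 4} (hj : j ≠ i) (hk : k ≠ i) :
    inner ℝ (outwardNormal p i) (p j - p k) = 0 := by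
  rw [outwardNormal, unit, smul_smul, inner_smul_left, inner_faceNormal_sub p hj hk, mul_zero]

/-- All nodes of the face have the same height over `p i`, so the sign taken at one of them serves
for every `j`. -/
theorem inner_outwardNormal_sub {i j : Fin 4} (hj : j ≠ i) :
    inner ℝ (outwardNormal p i) (p j - p i) =
      |inner ℝ (faceNormal p i) (p j - p i)| / ‖faceNormal p i‖ := by
  have h : inner ℝ (faceNormal p i) (p (i.succAbove 0) - p i) =
      inner ℝ (faceNormal p i) (p j - p i) := by
    rw [← sub_eq_zero, ← inner_sub_right, sub_sub_sub_cancel_right]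
    exact inner_faceNormal_sub p (Fin.succAbove_ne i 0) hj
  rw [outwardNormal, unit, smul_smul, inner_smul_left, h]
  simp only [RCLike.conj_to_real]
  rcases lt_trichotomy (inner ℝ (faceNormal p i) (p j - p i)) 0 with hx | hx | hx
  · rw [Real.sign_of_neg hx, abs_of_neg hx]; ring
  · simp [hx]
  · rw [Real.sign_of_pos hx, abs_of_pos hx]; ring

/-- Renumbering the nodes of a face changes its normal at most by a sign, which the quotient `|N ⬝
v| / ‖N‖` does not see. -/
theorem triangleNormal_swap_zero {a : Fin 4} (ha : a ≠ 0) :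
    triangleNormal ((p ∘ Equiv.swap 1 a) ∘ (0 : Fin 4).succAbove) = faceNormal p 0 ∨
    triangleNormal ((p ∘ Equiv.swap 1 a) ∘ (0 : Fin 4).succAbove) = -faceNormal p 0 := by
  have key : ∀ Q : Fin 4 → E3, triangleNormal (Q ∘ (0 : Fin 4).succAbove) =
      cross (Q 2 - Q 1) (Q 3 - Q 1) := fun _ => rfl
  have hf : faceNormal p 0 = cross (p 2 - p 1) (p 3 - p 1) := rfl
  rw [key, hf]
  fin_cases a
  · exact absurd rfl ha
  · left
    rfl
  · right
    change cross (p 1 - p 2) (p 3 - p 2) = _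
    ext i
    fin_cases i <;> simp [cross_zero, cross_one, cross_two] <;> ring
  · right
    change cross (p 2 - p 3) (p 1 - p 3) = _
    ext i
    fin_cases i <;> simp [cross_zero, cross_one, cross_two] <;> ring

theorem triangleNormal_swap_self {a : Fin 4} (ha : a ≠ 0) :
    triangleNormal ((p ∘ Equiv.swap 1 a) ∘ (1 : Fin 4).succAbove) = faceNormal p a ∨
    triangleNormal ((p ∘ Equiv.swap 1 a) ∘ (1 : Fin 4).succAbove) = -faceNormal p a := by
  have key : ∀ Q : Fin 4 → E3, triangleNormal (Q ∘ (1 : Fin 4).succAbove) =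
      cross (Q 2 - Q 0) (Q 3 - Q 0) := fun _ => rfl
  rw [key]
  fin_cases a
  · exact absurd rfl ha
  · left
    rfl
  · left
    rfl
  · right
    change cross (p 2 - p 0) (p 1 - p 0) = -cross (p 1 - p 0) (p 2 - p 0)
    ext i
    fin_cases i <;> simp [cross_zero, cross_one, cross_two] <;> ring

theorem abs_inner_div_norm_eq {N N' : E3} (h : N = N' ∨ N = -N') (v : E3) :
    |inner ℝ N v| / ‖N‖ = |inner ℝ N' v| / ‖N'‖ := by
  rcases h with rfl | rfl
  · rfl
  · rw [inner_neg_left, abs_neg, norm_neg]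

/-- The divergence theorem on a tetrahedron. -/
theorem setIntegral_tetra_fderiv {g : E3 → ℝ} {g' : E3 → E3 →L[ℝ] ℝ}
    (hg : ∀ x ∈ tetra p, HasFDerivAt g (g' x) x) (hg' : ContinuousOn g' (tetra p)) (v : E3) :
    ∫ r in tetra p, g' r v =
      inner ℝ (∑ i, (∫ r in face p i, g r ∂(Measure.euclideanHausdorffMeasure 2)) •
        outwardNormal p i) v := by
  have hint : IntegrableOn g' (tetra p) := hg'.integrableOn_compact (isCompact_tetra p)
  set I : Fin 4 → ℝ := fun i => ∫ r in face p i, g r ∂(Measure.euclideanHausdorffMeasure 2)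
  -- Integrating the derivative as a functional makes linearity in `v` automatic; it then suffices
  -- to test the basis of edges `p a - p 0`.
  have hL : ((∫ r in tetra p, g' r).toLinearMap : E3 →ₗ[ℝ] ℝ) =
      (innerSL ℝ (∑ i, I i • outwardNormal p i)).toLinearMap := by
    refine (p.basisOf 0).ext fun ⟨a, ha⟩ => ?_
    rw [AffineBasis.basisOf_apply]
    change (∫ r in tetra p, g' r) (p a - p 0) = inner ℝ (∑ i, I i • outwardNormal p i) (p a - p 0)
    rw [ContinuousLinearMap.integral_apply hint]
    -- Exchanging the nodes `1` and `a` moves the edge `p a - p 0` into the position required by the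
    -- edge lemma, without changing the tetrahedron.
    have hr : Set.range (p ∘ Equiv.swap 1 a) = Set.range p :=
      (Equiv.swap 1 a).surjective.range_comp p
    have h10 : (p ∘ Equiv.swap 1 a) 1 - (p ∘ Equiv.swap 1 a) 0 = p a - p 0 := by
      simp [Equiv.swap_apply_of_ne_of_ne (show (0 : Fin 4) ≠ 1 by decide) ha.symm]
    have hr0 : convexHull ℝ (Set.range ((p ∘ Equiv.swap 1 a) ∘ (0 : Fin 4).succAbove)) =
        face p 0 := by
      rw [Set.range_comp, Fin.range_succAbove, Set.image_comp,
        Set.image_compl_eq (Equiv.bijective _), Set.image_singleton,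
        Equiv.swap_apply_of_ne_of_ne (show (0 : Fin 4) ≠ 1 by decide) ha.symm]
      rfl
    have hr1 : convexHull ℝ (Set.range ((p ∘ Equiv.swap 1 a) ∘ (1 : Fin 4).succAbove)) =
        face p a := by
      rw [Set.range_comp, Fin.range_succAbove, Set.image_comp,
        Set.image_compl_eq (Equiv.bijective _), Set.image_singleton, Equiv.swap_apply_left]
      rfl
    have h := setIntegral_tetra_fderiv_edge
      (p.ind.comp_embedding (Equiv.swap 1 a).toEmbedding) (g := g) (g' := g')
      (by change ∀ x ∈ convexHull ℝ (Set.range (p ∘ Equiv.swap 1 a)), _; rwa [hr])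
      (by change ContinuousOn _ (convexHull ℝ (Set.range (p ∘ Equiv.swap 1 a))); rwa [hr])
    change ∫ r in convexHull ℝ (Set.range (p ∘ Equiv.swap 1 a)), g' r
      ((p ∘ Equiv.swap 1 a) 1 - (p ∘ Equiv.swap 1 a) 0) =
      |inner ℝ (triangleNormal ((p ∘ Equiv.swap 1 a) ∘ (0 : Fin 4).succAbove))
        ((p ∘ Equiv.swap 1 a) 1 - (p ∘ Equiv.swap 1 a) 0)| /
        ‖triangleNormal ((p ∘ Equiv.swap 1 a) ∘ (0 : Fin 4).succAbove)‖ *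
        ∫ r in convexHull ℝ (Set.range ((p ∘ Equiv.swap 1 a) ∘ (0 : Fin 4).succAbove)), g r
          ∂(Measure.euclideanHausdorffMeasure 2) -
      |inner ℝ (triangleNormal ((p ∘ Equiv.swap 1 a) ∘ (1 : Fin 4).succAbove))
        ((p ∘ Equiv.swap 1 a) 1 - (p ∘ Equiv.swap 1 a) 0)| /
        ‖triangleNormal ((p ∘ Equiv.swap 1 a) ∘ (1 : Fin 4).succAbove)‖ *
        ∫ r in convexHull ℝ (Set.range ((p ∘ Equiv.swap 1 a) ∘ (1 : Fin 4).succAbove)), g r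
          ∂(Measure.euclideanHausdorffMeasure 2) at h
    rw [h10, hr0, hr1, hr, abs_inner_div_norm_eq (triangleNormal_swap_zero p ha),
      abs_inner_div_norm_eq (triangleNormal_swap_self p ha), ← inner_outwardNormal_sub p ha,
      ← neg_sub (p 0) (p a), inner_neg_right (faceNormal p a), abs_neg,
      ← inner_outwardNormal_sub p ha.symm] at h
    rw [neg_sub] at h
    refine h.trans ?_
    rw [sum_inner]
    simp only [inner_smul_left, RCLike.conj_to_real]
    -- Only the faces opposite `p 0` and `p a` contribute: each of the other two contains both
    -- nodes, so its normal is orthogonal to the edge.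
    rw [← Finset.add_sum_erase _ _ (Finset.mem_univ (0 : Fin 4)), ← Finset.add_sum_erase _ _
      (Finset.mem_erase.2 ⟨ha, Finset.mem_univ a⟩), Finset.sum_eq_zero, ← neg_sub (p 0) (p a),
      inner_neg_right, inner_neg_right]
    · ring
    · intro c hc
      simp only [Finset.mem_erase] at hc
      rw [inner_outwardNormal_sub_of_ne p (Ne.symm hc.1) (Ne.symm hc.2.1), mul_zero]
  rw [← ContinuousLinearMap.integral_apply hint]
  exact LinearMap.congr_fun hL v

/-! ### The volume element vector -/

/-- The coefficients of the linear part of the volume coordinate `φ_i`. -/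
def coordGradient (i : Fin 4) : Fin 3 → ℝ :=
  fun k => (p.coord i).linear (EuclideanSpace.single k 1)

theorem gradient_coord (i : Fin 4) (r : E3) :
    ∇ (fun x => p.coord i x) r = WithLp.toLp 2 (coordGradient p i) := by
  have h : HasGradientAt (fun x => p.coord i x) (WithLp.toLp 2 (coordGradient p i) : E3) r := by
    rw [hasGradientAt_iff_hasFDerivAt]
    have hd : ∀ x : E3, p.coord i x =
        InnerProductSpace.toDual ℝ E3 (WithLp.toLp 2 (coordGradient p i)) x + p.coord i 0 := by
      intro x
      have hV := (vol_pos p).ne'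
      rw [coord_eq p i x, coord_eq p i 0, InnerProductSpace.toDual_apply_apply, inner_eq]
      simp only [Lam, coordGradient, Matrix.mulVec, dotProduct, Fin.sum_univ_three]
      simp
      field_simp
      ring
    exact ((InnerProductSpace.toDual ℝ E3 (WithLp.toLp 2 (coordGradient p i))).hasFDerivAt.add_const
      (p.coord i 0)).congr_of_eventuallyEq (Filter.Eventually.of_forall hd)
  exact h.gradient

theorem inner_toLp_mulVec (σ : Matrix (Fin 3) (Fin 3) ℝ) (x : E3) (c : Fin 3 → ℝ) :
    inner ℝ (WithLp.toLp 2 (σ *ᵥ x.ofLp) : E3) (WithLp.toLp 2 c) =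
      inner ℝ x (WithLp.toLp 2 (c ᵥ* σ)) := by
  simp only [inner_eq, Matrix.mulVec, Matrix.vecMul, dotProduct, Fin.sum_univ_three]
  ring

/-- Moving the conductivity onto the constant vector `∇φ_i` leaves a directional derivative of `f`
along a fixed vector, the form needed for the divergence theorem. -/
theorem bvIntegrand_eq (σc : Matrix (Fin 3) (Fin 3) ℝ) (q r0 : E3) (i : Fin 4) (r : E3) :
    bvIntegrand p σc q r0 i r =
      fderiv ℝ (dipole q r0) r (WithLp.toLp 2 (coordGradient p i ᵥ* σc)) := by
  rw [bvIntegrand, gradient_coord, inner_toLp_mulVec, gradient,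
    InnerProductSpace.toDual_symm_apply]

theorem volume_element {r0 : E3} (hr0 : r0 ∉ tetra p) (σc : Matrix (Fin 3) (Fin 3) ℝ)
    (σinf : ℝ) (q : E3) :
    (∀ i, IntegrableOn (bvIntegrand p σc q r0 i) (tetra p)) ∧
    bv p σc σinf q r0 =
      (1 / (24 * vol p * π * σinf)) • (((Lam p)ᵀ * σc) *ᵥ
        (∑ i, (∫ r in face p i, dipole q r0 r ∂(Measure.euclideanHausdorffMeasure 2)) •
          outwardNormal p i).ofLp) := by
  have hsub : tetra p ⊆ {r0}ᶜ := fun r hr h => hr0 (h ▸ hr)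
  have hc : ContinuousOn (fderiv ℝ (dipole q r0)) (tetra p) :=
    (continuousOn_fderiv_of_contDiffOn_compl (contDiffOn_dipole q r0)).mono hsub
  constructor
  · intro i
    have h := bvIntegrand_eq p σc q r0 i
    rw [funext h]
    exact (hc.clm_apply continuousOn_const).integrableOn_compact (isCompact_tetra p)
  · ext i
    simp only [bv, bvIntegrand_eq]
    rw [setIntegral_tetra_fderiv p
      (fun x hx => hasFDerivAt_of_contDiffOn_compl (contDiffOn_dipole q r0) (hsub hx)) hc]
    set S := ∑ i, (∫ r in face p i, dipole q r0 r ∂(Measure.euclideanHausdorffMeasure 2)) •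
      outwardNormal p i
    have hV := (vol_pos p).ne'
    -- The factor `6V` in `Λ` cancels against `24V`, leaving the `4` of `1 / (4πσ^∞)`.
    have hL : ∀ k, Lam p k i = 6 * vol p * coordGradient p i k := fun k => rfl
    simp only [inner_eq, Matrix.mulVec, Matrix.vecMul, dotProduct, Fin.sum_univ_three,
      Pi.smul_apply, smul_eq_mul, Matrix.mul_apply, Matrix.transpose_apply, hL]
    field_simp
    ring

/-! ### The face integrals -/

theorem range_numbering {i : Fin 4} (e : Fin 3 ≃ {j : Fin 4 // j ≠ i}) :
    convexHull ℝ (Set.range fun k => p (e k)) = face p i := by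
  have h : (Set.range fun k => p (e k)) = p '' {j | j ≠ i} := by
    ext x
    constructor
    · rintro ⟨k, rfl⟩
      exact ⟨e k, (e k).2, rfl⟩
    · rintro ⟨j, hj, rfl⟩
      exact ⟨e.symm ⟨j, hj⟩, by simp⟩
  rw [h, face]

theorem face_integral {r0 : E3} {i : Fin 4} (hr0 : r0 ∉ face p i) (q : E3) :
    IntegrableOn (dipole q r0) (face p i) (Measure.euclideanHausdorffMeasure 2) ∧
    IntegrableOn (fun r => ∇ (invDist r0) r) (face p i) (Measure.euclideanHausdorffMeasure 2) ∧
    ∫ r in face p i, dipole q r0 r ∂(Measure.euclideanHausdorffMeasure 2) =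
      -inner ℝ q (∫ r in face p i, ∇ (invDist r0) r ∂(Measure.euclideanHausdorffMeasure 2)) := by
  have hsub : face p i ⊆ {r0}ᶜ := fun r hr h => hr0 (h ▸ hr)
  have hm : MeasurableSet (face p i) :=
    ((((Set.finite_range _).subset (Set.image_subset_range p _))).isCompact_convexHull
      ℝ).isClosed.measurableSet
  have hN : triangleNormal (p ∘ i.succAbove) ≠ 0 := faceNormal_ne_zero p i
  have hg : IntegrableOn (fun r => ∇ (invDist r0) r) (face p i)
      (Measure.euclideanHausdorffMeasure 2) := by
    have h := (continuousOn_gradient_invDist r0).mono hsub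
    rw [face_eq] at h ⊢
    exact integrableOn_triangle _ hN h
  have hd : IntegrableOn (dipole q r0) (face p i) (Measure.euclideanHausdorffMeasure 2) := by
    have h := (contDiffOn_dipole q r0).continuousOn.mono hsub
    rw [face_eq] at h ⊢
    exact integrableOn_triangle _ hN h
  refine ⟨hd, hg, ?_⟩
  rw [← integral_inner hg, ← integral_neg]
  exact setIntegral_congr_fun hm fun r hr => dipole_eq (hsub hr)

end Tetrahedron

end EEG

end

theorem mainTheorem4 (p : AffineBasis (Fin 4) ℝ EEG.E3) (σc : Matrix (Fin 3) (Fin 3) ℝ)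
    (σinf : ℝ) (hσ : 0 < σinf) (q r0 : EEG.E3) :
    -- the volume element vector, for a source outside the closed tetrahedron
    (r0 ∉ EEG.tetra p →
      (∀ i, IntegrableOn (EEG.bvIntegrand p σc q r0 i) (EEG.tetra p)) ∧
      EEG.bv p σc σinf q r0 =
        (1 / (24 * EEG.vol p * π * σinf)) • (((EEG.Lam p)ᵀ * σc) *ᵥ
          (∑ i, (∫ r in EEG.face p i, EEG.dipole q r0 r ∂(Measure.euclideanHausdorffMeasure 2)) •
            EEG.outwardNormal p i).ofLp)) ∧
    -- the face integrals, for a source off the face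
    (∀ i : Fin 4, r0 ∉ EEG.face p i →
      IntegrableOn (EEG.dipole q r0) (EEG.face p i) (Measure.euclideanHausdorffMeasure 2) ∧
      IntegrableOn (fun r => ∇ (EEG.invDist r0) r) (EEG.face p i)
        (Measure.euclideanHausdorffMeasure 2) ∧
      ∫ r in EEG.face p i, EEG.dipole q r0 r ∂(Measure.euclideanHausdorffMeasure 2) =
        -inner ℝ q (∫ r in EEG.face p i, ∇ (EEG.invDist r0) r
          ∂(Measure.euclideanHausdorffMeasure 2)) ∧
      -- for every numbering of the nodes of the face for which the logarithms are defined
      ∀ e : Fin 3 ≃ {j : Fin 4 // j ≠ i},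
        (∀ l, EEG.RMinus (fun k => p (e k)) r0 l + EEG.sMinus (fun k => p (e k)) r0 l ≠ 0) →
        ∫ r in EEG.face p i, EEG.dipole q r0 r ∂(Measure.euclideanHausdorffMeasure 2) =
          -inner ℝ q (EEG.faceVector (fun k => p (e k)) r0)) := by
  refine ⟨fun h => EEG.volume_element p h σc σinf q, fun i hi => ?_⟩
  obtain ⟨h1, h2, h3⟩ := EEG.face_integral p hi q
  refine ⟨h1, h2, h3, fun e he => ?_⟩
  have hr := EEG.range_numbering p e
  -- The surface integral depends only on the face as a set, so the closed form holds in the frame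
  -- of any numbering.
  rw [h3, ← hr, EEG.setIntegral_gradient_invDist (P := fun k => p (e k)) ?_ (by rwa [hr]) he]
  exact EEG.triangleNormal_ne_zero
    (p.ind.comp_embedding (e.toEmbedding.trans (Function.Embedding.subtype _)))
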